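/- Let $P\subset\mathbb C$ be finite, $\Omega=\mathbb C\setminus P$, and let $f:\Omega\to\mathbb C$ be a non-degenerate harmonic mapping with set of poles $P$. That is: (1) $\Delta f=0$ on $\Omega$, and $\lim_{z\to p}f(z)=\infty$ for every $p\in P$; (2) near each $p\in P$, $$f(z)=\sum_{k\ge -n}a_k(z-p)^k+\overline{\sum_{k\ge -n}b_k(z-p)^k}+c\log|z-p|$$ with some $n\ge 1$ and $|a_{-n}|\ne|b_{-n}|$; (3) the Jacobian $J_f=|\partial_zf|^2-|\partial_{\bar z}f|^2$ is positive for all sufficiently large $|z|$. Let $\mathcal C=\{z\in\Omega: J_f(z)=0\}$ be the critical set, let $\omega=\overline{\partial_{\bar z}f}/\partial_zf$ be the second complex dilatation, a meromorphic function on $\Omega$ with removable singularities removed, and let $\mathcal M=\{z\in\mathcal C:|\omega(z)|\neq1\}$. For a connected component $\Gamma$ of $\mathcal C\setminus\mathcal M$, a critical curve for $\Gamma$ is a closed curve $\gamma:[a,b]\to\mathbb C$, $a<b$, with trace $\Gamma$, with $\omega(\gamma(t))=e^{it}$ for all $t\in[a,b]$, and passing exactly once (for $t\in[a,b)$) through every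 point of $\Gamma$ where $\omega'\ne0$. The set $\mathcal C\setminus\mathcal M$ has only finitely many components, and each of them has a critical curve. Let $\mathrm{crit}$ consist of one critical curve (any choice) for each component. Let $\eta\in\mathbb C\setminus f(\mathcal C)$ be such that $\infty$ is an isolated exceptional point of $f-\eta$, i.e. $f(z)\ne\eta$ for all sufficiently large $|z|$. Then the number $N_\eta(f)$ of pre-images of $\eta$ under $f$ in $\Omega$ is finite, and $$N_\eta(f)=2\sum_{\gamma\in\mathrm{crit}}\mathrm{wind}(f\circ\gamma;\eta)+P(f)-\mathrm{ind}(f-\eta;\infty).$$ Here $\mathrm{wind}(f\circ\gamma;\eta)$ is the winding number of the closed curve $f\circ\gamma$ about $\eta$, and $P(f)=\sum_{p\in P}|\mathrm{ind}(f;p)|$, where the Poincaré index $\mathrm{ind}(f;p)$ is the change of argument of $f$, divided by $2\pi$, along any sufficiently small positively oriented circle about $p$; $\mathrm{ind}(f-\eta;\infty)$ is the change of argument of $f-\eta$, divided by $2\pi$, along any sufficiently large negatively oriented circle about $0$. -/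

import Mathlib

open Set Filter Topology

namespace HarmonicMapping

noncomputable section

/-- The Wirtinger derivative `∂f/∂z = (∂ₓ f - i ∂ᵧ f) / 2`. -/
def dz (f : ℂ → ℂ) (z : ℂ) : ℂ :=
  (fderiv ℝ f z 1 - Complex.I * fderiv ℝ f z Complex.I) / 2

/-- The Wirtinger derivative `∂f/∂z̄ = (∂ₓ f + i ∂ᵧ f) / 2`. -/
def dzbar (f : ℂ → ℂ) (z : ℂ) : ℂ :=
  (fderiv ℝ f z 1 + Complex.I * fderiv ℝ f z Complex.I) / 2

/-- The Jacobian `|∂f/∂z|² - |∂f/∂z̄|²`. -/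
def jacobian (f : ℂ → ℂ) (z : ℂ) : ℝ :=
  ‖dz f z‖ ^ 2 - ‖dzbar f z‖ ^ 2

/-- `f`, harmonic on a punctured neighbourhood of `p`, is there of the form
`∑_{k ≥ -n} a_k (z - p)^k + conj (∑_{k ≥ -n} b_k (z - p)^k) + c log |z - p|` with `n ≥ 1` and
`|a_{-n}| ≠ |b_{-n}|`. Here `A z = ∑_{k ≥ 0} a_{k-n} (z - p)^k` and
`B z = ∑_{k ≥ 0} b_{k-n} (z - p)^k`. -/
def HasNondegenerateForm (f : ℂ → ℂ) (p : ℂ) : Prop :=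
  ∃ (n : ℕ) (A B : ℂ → ℂ) (c : ℂ), 1 ≤ n ∧ AnalyticAt ℂ A p ∧ AnalyticAt ℂ B p ∧
    ‖A p‖ ≠ ‖B p‖ ∧
    ∀ᶠ z in 𝓝[≠] p, f z = A z / (z - p) ^ n + starRingEnd ℂ (B z / (z - p) ^ n)
      + c * (Real.log ‖z - p‖ : ℂ)

/-- `f` is a non-degenerate harmonic mapping on `ℂ \ P`, where `P` is its finite set of poles.
The values of `f` on `P` are irrelevant. -/
structure IsNondegenerate (f : ℂ → ℂ) (P : Finset ℂ) : Prop where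
  harmonic : InnerProductSpace.HarmonicOnNhd f ((P : Set ℂ)ᶜ)
  pole : ∀ p ∈ P, Tendsto f (𝓝[≠] p) (Bornology.cobounded ℂ)
  pole_form : ∀ p ∈ P, HasNondegenerateForm f p
  sense_preserving_at_infty : ∀ᶠ z in Bornology.cobounded ℂ, 0 < jacobian f z

/-- The critical set `𝒞` of `f : ℂ \ P → ℂ`. -/
def criticalSet (f : ℂ → ℂ) (P : Finset ℂ) : Set ℂ :=
  {z | z ∉ P ∧ jacobian f z = 0}

/-- The second complex dilatation `ω = conj (∂f/∂z̄) / (∂f/∂z)` on `ℂ \ P`, with removable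
singularities removed (the normal form of the meromorphic quotient; at a pole of `ω` the normal
form has the value `0`, so that poles of `ω` do not lie on the level set `|ω| = 1`). -/
def dilatation (f : ℂ → ℂ) (P : Finset ℂ) : ℂ → ℂ :=
  toMeromorphicNFOn (fun z => starRingEnd ℂ (dzbar f z) / dz f z) ((P : Set ℂ)ᶜ)

/-- The set `ℳ` of the critical points with `|ω| ≠ 1`. -/
def exceptionalSet (f : ℂ → ℂ) (P : Finset ℂ) : Set ℂ :=
  {z | z ∈ criticalSet f P ∧ ‖dilatation f P z‖ ≠ 1}

/-- The connected components of `𝒞 \ ℳ`. -/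
def criticalComponents (f : ℂ → ℂ) (P : Finset ℂ) : Set (Set ℂ) :=
  {Γ | ∃ z ∈ criticalSet f P \ exceptionalSet f P,
    Γ = connectedComponentIn (criticalSet f P \ exceptionalSet f P) z}

/-- A curve `[a, b] → ℂ`; the values of `toFun` outside `[a, b]` are irrelevant. -/
structure Curve where
  a : ℝ
  b : ℝ
  a_lt_b : a < b
  toFun : ℝ → ℂ
  continuousOn : ContinuousOn toFun (Icc a b)

/-- `γ` is a critical curve of `f` parametrizing the component `Γ` of `𝒞 \ ℳ`: a closed curve with
trace `Γ` and `ω (γ t) = e^{it}`, which travels through every critical arc once. The critical arcs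
meet at the zeros of `ω'`, so the last condition is that every point of `Γ` with `ω' ≠ 0` is
visited exactly once. -/
structure IsCriticalCurve (f : ℂ → ℂ) (P : Finset ℂ) (Γ : Set ℂ) (γ : Curve) : Prop where
  closed : γ.toFun γ.a = γ.toFun γ.b
  trace : γ.toFun '' Icc γ.a γ.b = Γ
  dilatation_eq : ∀ t ∈ Icc γ.a γ.b,
    dilatation f P (γ.toFun t) = Complex.exp (t * Complex.I)
  once : ∀ z ∈ Γ, deriv (dilatation f P) z ≠ 0 → ∃! t, t ∈ Ico γ.a γ.b ∧ γ.toFun t = z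

/-- `θ` is a continuous choice of the argument of `g` on `[a, b]` (in particular `g` has no zero
there). -/
def IsArgumentOn (g : ℝ → ℂ) (a b : ℝ) (θ : ℝ → ℝ) : Prop :=
  ContinuousOn θ (Icc a b) ∧
    ∀ t ∈ Icc a b, g t ≠ 0 ∧ g t = ‖g t‖ * Complex.exp (θ t * Complex.I)

open Classical in
/-- The change of the argument of `g` along `[a, b]`, divided by `2π`. It does not depend on the
choice of the continuous argument, which exists if `g` is continuous and non-zero on `[a, b]`. -/
def argChange (g : ℝ → ℂ) (a b : ℝ) : ℝ :=
  if h : ∃ θ, IsArgumentOn g a b θ then (h.choose b - h.choose a) / (2 * Real.pi) else 0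

/-- The winding `W(f; γ)` of `f` on `γ`. The winding number of `f ∘ γ` about `η` is
`winding (fun z => f z - η) γ`. -/
def winding (f : ℂ → ℂ) (γ : Curve) : ℝ :=
  argChange (fun t => f (γ.toFun t)) γ.a γ.b

/-- The Poincaré index of `f` at an isolated exceptional point `p ∈ ℂ`: the winding of `f` on all
sufficiently small positively oriented circles about `p`. -/
def index (f : ℂ → ℂ) (p : ℂ) : ℝ :=
  limUnder (𝓝[>] (0 : ℝ)) fun r =>
    argChange (fun t => f (p + r * Complex.exp (t * Complex.I))) 0 (2 * Real.pi)

/-- The Poincaré index of `f` at the isolated exceptional point `∞`: the winding of `f` on all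
sufficiently large negatively oriented circles about `0`. -/
def indexInfty (f : ℂ → ℂ) : ℝ :=
  limUnder atTop fun R : ℝ =>
    argChange (fun t => f (R * Complex.exp (-(t * Complex.I)))) 0 (2 * Real.pi)

/-- The pre-images of `η` under `f : ℂ \ P → ℂ`. -/
def preimages (f : ℂ → ℂ) (P : Finset ℂ) (η : ℂ) : Set ℂ :=
  {z | z ∉ P ∧ f z = η}

/-- The number of poles, counted with the absolute values of their Poincaré indices. -/
def poleCount (f : ℂ → ℂ) (P : Finset ℂ) : ℝ :=
  ∑ p ∈ P, |index f p|

end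

end HarmonicMapping

open Set Filter Topology

/-! The pole form makes the dilatation ω meromorphic on all of ℂ, and the positive Jacobian bounds
it by 1 near infinity. Hence ω is rational: ω = u/v with u, v coprime and |u| < |v| near infinity
(`IsNondegenerate.exists_rational_dilatation`). At a pole, |a_{-n}| ≠ |b_{-n}| gives |ω| ≠ 1, so 𝒞 \
ℳ is exactly the level set |u| = |v|.

This level set is traced by the roots of u - e^{it} v, 0 ≤ t ≤ 2π. The degree is constantly d = deg
v, because the coefficients of degree d satisfy |u_d| < |v_d|. So the d roots can be followed
continuously, and one turn permutes them by some σ. If the numbering is such that roots which meet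
lie on one cycle of σ, then the cycles of σ are the components, and running through a cycle gives a
critical curve (`exists_curve_of_level_component`).

For an arbitrary choice of critical curves and a point x off the level set, consider the product of
γ(t + 2πk) - x over all curves and all their lifts. At a level t with simple roots the lifts
enumerate the roots, so up to sign the product is (u(x) - e^{it} v(x)) / (u_d - e^{it} v_d); by
density this holds for all t. Therefore the total winding about x is 0 if |ω(x)| < 1 and -1 if
|ω(x)| > 1 (`sum_argChange_curve_sub`).

Finally, let a run through the poles and the finitely many preimages of η, with indices n_a. On the
level set and near infinity, f - η is ∏ (z - a)^{n_a} times the exponential of a continuous function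
(`exists_log_factorization`). This is an argument principle: the total winding V of the images of
the critical curves is minus the sum of n_a over |ω(a)| > 1, and the index at infinity is -∑ n_a. At
a preimage n_a is 1 if |ω(a)| < 1 and -1 if |ω(a)| > 1; at a pole n_a ≤ 0 or n_a ≥ 0, respectively.
Thus in 2V + P(f) - ind(f - η; ∞) each preimage contributes 1 and each pole 0. -/

namespace HarmonicMapping

/-! ### Continuous logarithms and the change of argument -/

/-- A continuous function without zeros on a simply connected space has a continuous logarithm. -/
theorem exists_continuous_log {X : Type*} [TopologicalSpace X] [SimplyConnectedSpace X]
    [LocallyPathConnectedSpace X] {g : X → ℂ} (hg : Continuous g) (h0 : ∀ x, g x ≠ 0) :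
    ∃ l : X → ℂ, Continuous l ∧ ∀ x, Complex.exp (l x) = g x := by
  obtain ⟨x₀⟩ : Nonempty X := inferInstance
  obtain ⟨l, ⟨-, hl⟩, -⟩ := Complex.isCoveringMapOn_exp.existsUnique_continuousMap_lifts
    (⟨g, hg⟩ : C(X, ℂ)) (a₀ := x₀) (Complex.exp_log (h0 x₀)) (fun x => h0 x)
  exact ⟨l, l.continuous, fun x => congrFun hl x⟩

theorem exists_continuousOn_log_Icc {g : ℝ → ℂ} {a b : ℝ} (hab : a ≤ b)
    (hg : ContinuousOn g (Icc a b)) (h0 : ∀ t ∈ Icc a b, g t ≠ 0) :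
    ∃ l : ℝ → ℂ, ContinuousOn l (Icc a b) ∧ ∀ t ∈ Icc a b, Complex.exp (l t) = g t := by
  obtain ⟨l, hl, hl'⟩ := exists_continuous_log (X := ℝ)
    (g := IccExtend hab (fun t : Icc a b => g t))
    ((continuousOn_iff_continuous_domRestrict.1 hg).Icc_extend')
    (fun t => h0 _ (projIcc a b hab t).2)
  refine ⟨l, hl.continuousOn, fun t ht => ?_⟩
  rw [hl', IccExtend_of_mem hab _ ht]

/-- Two continuous logarithms of a function on a preconnected set differ by a constant. -/
theorem sub_eq_sub_of_exp_eq {X : Type*} [TopologicalSpace X] {s : Set X} (hs : IsPreconnected s)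
    {l m : X → ℂ} (hl : ContinuousOn l s) (hm : ContinuousOn m s)
    (h : ∀ x ∈ s, Complex.exp (l x) = Complex.exp (m x)) {x y : X} (hx : x ∈ s) (hy : y ∈ s) :
    l x - m x = l y - m y := by
  have := NormedSpace.discreteTopology_zmultiples (2 * Real.pi * Complex.I : ℂ)
  -- The difference is continuous with values in the discrete group 2πiℤ.
  refine hs.constant_of_mapsTo
    (T := (AddSubgroup.zmultiples (2 * Real.pi * Complex.I : ℂ) : Set ℂ))
    (f := fun x => l x - m x) ⟨this⟩ (hl.sub hm) (fun z hz => ?_) hx hy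
  obtain ⟨n, hn⟩ := Complex.exp_eq_exp_iff_exists_int.1 (h z hz)
  refine ⟨n, ?_⟩
  simp [hn]

theorem IsArgumentOn.argChange_eq {g : ℝ → ℂ} {a b : ℝ} (hab : a ≤ b) {θ : ℝ → ℝ}
    (h : IsArgumentOn g a b θ) : argChange g a b = (θ b - θ a) / (2 * Real.pi) := by
  have hex : ∃ θ, IsArgumentOn g a b θ := ⟨θ, h⟩
  rw [argChange, dif_pos hex]
  have h' := hex.choose_spec
  set φ := hex.choose
  have key := sub_eq_sub_of_exp_eq (s := Icc a b) isPreconnected_Icc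
    (l := fun t => (φ t : ℂ) * Complex.I) (m := fun t => (θ t : ℂ) * Complex.I)
    ((Complex.continuous_ofReal.comp_continuousOn h'.1).mul continuousOn_const)
    ((Complex.continuous_ofReal.comp_continuousOn h.1).mul continuousOn_const)
    (fun t ht => by
      have h1 := (h'.2 t ht).2
      have h2 := (h.2 t ht).2
      have h3 : (‖g t‖ : ℂ) ≠ 0 := by simpa using (h.2 t ht).1
      exact mul_left_cancel₀ h3 (h1.symm.trans h2))
    (right_mem_Icc.2 hab) (left_mem_Icc.2 hab)
  have := congrArg Complex.im key
  simp at this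
  congr 1
  linarith

theorem isArgumentOn_im_log {g : ℝ → ℂ} {a b : ℝ} {l : ℝ → ℂ}
    (hl : ContinuousOn l (Icc a b)) (h : ∀ t ∈ Icc a b, Complex.exp (l t) = g t) :
    IsArgumentOn g a b fun t => (l t).im := by
  refine ⟨Complex.continuous_im.comp_continuousOn hl, fun t ht => ?_⟩
  rw [← h t ht]
  refine ⟨Complex.exp_ne_zero _, ?_⟩
  rw [Complex.norm_exp, Complex.ofReal_exp, ← Complex.exp_add, Complex.re_add_im]

theorem argChange_eq_of_log {g : ℝ → ℂ} {a b : ℝ} (hab : a ≤ b) {l : ℝ → ℂ}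
    (hl : ContinuousOn l (Icc a b)) (h : ∀ t ∈ Icc a b, Complex.exp (l t) = g t) :
    argChange g a b = (l b - l a).im / (2 * Real.pi) := by
  rw [(isArgumentOn_im_log hl h).argChange_eq hab, Complex.sub_im]

/-- Logarithms of the factors add up, and the factor `exp (l t)` contributes nothing because `l`
returns to its initial value. -/
theorem argChange_prod_zpow_mul_exp {ι : Type*} (S : Finset ι) (n : ι → ℤ) (g : ι → ℝ → ℂ)
    {F : ℝ → ℂ} {a b : ℝ} (hab : a ≤ b) (hg : ∀ i ∈ S, ContinuousOn (g i) (Icc a b))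
    (h0 : ∀ i ∈ S, ∀ t ∈ Icc a b, g i t ≠ 0) {l : ℝ → ℂ} (hl : ContinuousOn l (Icc a b))
    (hclosed : l b = l a)
    (hF : ∀ t ∈ Icc a b, F t = (∏ i ∈ S, g i t ^ n i) * Complex.exp (l t)) :
    argChange F a b = ∑ i ∈ S, n i * argChange (g i) a b := by
  have : ∀ i, ∃ m : ℝ → ℂ, i ∈ S → ContinuousOn m (Icc a b) ∧
      ∀ t ∈ Icc a b, Complex.exp (m t) = g i t := fun i => by
    by_cases hi : i ∈ S
    · obtain ⟨m, hm⟩ := exists_continuousOn_log_Icc hab (hg i hi) (h0 i hi)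
      exact ⟨m, fun _ => hm⟩
    · exact ⟨0, fun h => absurd h hi⟩
  choose m hm using this
  rw [argChange_eq_of_log hab (l := fun t => (∑ i ∈ S, n i * m i t) + l t)]
  · rw [hclosed, add_sub_add_right_eq_sub, ← Finset.sum_sub_distrib, Complex.im_sum,
      Finset.sum_div]
    refine Finset.sum_congr rfl fun i hi => ?_
    rw [argChange_eq_of_log hab (hm i hi).1 (hm i hi).2, ← mul_sub, mul_div_assoc']
    congr 1
    simp
  · refine (continuousOn_finsetSum _ fun i hi => ?_).add hl
    exact continuousOn_const.mul (hm i hi).1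
  · intro t ht
    rw [hF t ht, Complex.exp_add, Complex.exp_sum]
    congr 1
    refine Finset.prod_congr rfl fun i hi => ?_
    rw [Complex.exp_int_mul, (hm i hi).2 t ht]

/-- The constant term dominates: after division by `p` all values lie in the right half-plane, where
the principal logarithm is continuous. -/
theorem argChange_sub_exp_eq_zero {p q : ℂ} (h : ‖q‖ < ‖p‖) :
    argChange (fun t => p - Complex.exp (t * Complex.I) * q) 0 (2 * Real.pi) = 0 := by
  have hp : p ≠ 0 := norm_pos_iff.1 ((norm_nonneg q).trans_lt h)
  have hs : ∀ t : ℝ, 1 - Complex.exp (t * Complex.I) * (q / p) ∈ Complex.slitPlane := by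
    intro t
    left
    have : ‖Complex.exp (t * Complex.I) * (q / p)‖ < 1 := by
      rw [norm_mul, Complex.norm_exp_ofReal_mul_I, one_mul, norm_div]
      exact (div_lt_one (norm_pos_iff.2 hp)).2 h
    have := (Complex.re_le_norm _).trans_lt this
    simp only [Complex.sub_re, Complex.one_re]
    linarith
  rw [argChange_eq_of_log Real.two_pi_pos.le
    (l := fun t => Complex.log p + Complex.log (1 - Complex.exp (t * Complex.I) * (q / p)))]
  · simp
  · refine continuousOn_const.add fun t _ => ContinuousAt.continuousWithinAt ?_
    refine ContinuousAt.clog ?_ (hs t)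
    fun_prop
  · intro t _
    rw [Complex.exp_add, Complex.exp_log hp, Complex.exp_log (Complex.slitPlane_ne_zero (hs t))]
    field_simp

/-- Factoring out `-e^{it} q` leaves values in the right half-plane, so only `e^{it}` turns. -/
theorem argChange_sub_exp_eq_one {p q : ℂ} (h : ‖p‖ < ‖q‖) :
    argChange (fun t => p - Complex.exp (t * Complex.I) * q) 0 (2 * Real.pi) = 1 := by
  have hq : q ≠ 0 := norm_pos_iff.1 ((norm_nonneg p).trans_lt h)
  have hs : ∀ t : ℝ, 1 - Complex.exp (-(t * Complex.I)) * (p / q) ∈ Complex.slitPlane := by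
    intro t
    left
    have : ‖Complex.exp (-(t * Complex.I)) * (p / q)‖ < 1 := by
      have e : -((t : ℂ) * Complex.I) = ((-t : ℝ) : ℂ) * Complex.I := by push_cast; ring
      rw [norm_mul, e, Complex.norm_exp_ofReal_mul_I, one_mul, norm_div]
      exact (div_lt_one (norm_pos_iff.2 hq)).2 h
    have := (Complex.re_le_norm _).trans_lt this
    simp only [Complex.sub_re, Complex.one_re]
    linarith
  rw [argChange_eq_of_log Real.two_pi_pos.le
    (l := fun t => Complex.log (-q) + t * Complex.I +
      Complex.log (1 - Complex.exp (-(t * Complex.I)) * (p / q)))]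
  · have : Complex.exp (-(2 * Real.pi * Complex.I)) = 1 := by
      rw [Complex.exp_neg, Complex.exp_two_pi_mul_I, inv_one]
    simp [this]
  · refine ContinuousOn.add (by fun_prop) fun t _ => ContinuousAt.continuousWithinAt ?_
    refine ContinuousAt.clog ?_ (hs t)
    fun_prop
  · intro t _
    rw [Complex.exp_add, Complex.exp_add, Complex.exp_log (neg_ne_zero.2 hq),
      Complex.exp_log (Complex.slitPlane_ne_zero (hs t)), Complex.exp_neg]
    have := Complex.exp_ne_zero (t * Complex.I)
    field_simp
    ring

/-! ### Local indices and the argument principle -/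

/-- Near `a`, the function `F` is `(z - a) ^ n` up to a factor with a continuous logarithm. -/
def HasLocalIndex (F : ℂ → ℂ) (a : ℂ) (n : ℤ) : Prop :=
  ∃ r > 0, ∃ L : ℂ → ℂ, ContinuousOn L (Metric.ball a r \ {a}) ∧
    ∀ z ∈ Metric.ball a r \ {a}, F z = (z - a) ^ n * Complex.exp (L z)

theorem HasLocalIndex.index_eq {F : ℂ → ℂ} {a : ℂ} {n : ℤ} (h : HasLocalIndex F a n) :
    index F a = n := by
  obtain ⟨r, hr, L, hL, hF⟩ := h
  refine Tendsto.limUnder_eq (tendsto_const_nhds.congr' ?_)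
  filter_upwards [Ioo_mem_nhdsGT hr] with ρ hρ
  have hmem : ∀ t : ℝ, a + ρ * Complex.exp (t * Complex.I) ∈ Metric.ball a r \ {a} := by
    intro t
    have h1 : (ρ : ℂ) ≠ 0 := by exact_mod_cast hρ.1.ne'
    refine ⟨?_, ?_⟩
    · simpa [abs_of_pos hρ.1, Complex.norm_exp_ofReal_mul_I] using hρ.2
    · simp [h1]
  rw [argChange_eq_of_log Real.two_pi_pos.le
    (l := fun t => n * (Complex.log ρ + t * Complex.I) +
      L (a + ρ * Complex.exp (t * Complex.I)))]
  · simp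
    have := Real.pi_ne_zero
    field_simp
    ring
  · refine ContinuousOn.add (by fun_prop) ?_
    exact hL.comp (by fun_prop) fun t _ => hmem t
  · intro t _
    have h1 : (ρ : ℂ) ≠ 0 := by exact_mod_cast hρ.1.ne'
    rw [hF _ (hmem t), Complex.exp_add, Complex.exp_int_mul, Complex.exp_add, Complex.exp_log h1]
    simp

theorem hasLocalIndex_of_eventually {F : ℂ → ℂ} {a : ℂ} {n : ℤ} {L : ℂ → ℂ}
    (hL : ∀ᶠ z in 𝓝[≠] a, ContinuousAt L z)
    (hF : ∀ᶠ z in 𝓝[≠] a, F z = (z - a) ^ n * Complex.exp (L z)) : HasLocalIndex F a n := by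
  obtain ⟨r, hr, h⟩ := Metric.mem_nhdsWithin_iff.1 (hL.and hF)
  exact ⟨r, hr, L, fun z hz => (h hz).1.continuousWithinAt, fun z hz => (h hz).2⟩

theorem HasLocalIndex.eventually {F : ℂ → ℂ} {a : ℂ} {n : ℤ} (h : HasLocalIndex F a n) :
    ∃ L : ℂ → ℂ, (∀ᶠ z in 𝓝[≠] a, ContinuousAt L z) ∧
      ∀ᶠ z in 𝓝[≠] a, F z = (z - a) ^ n * Complex.exp (L z) := by
  obtain ⟨r, hr, L, hL, hF⟩ := h
  have hm : Metric.ball a r \ {a} ∈ 𝓝[≠] a :=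
    Metric.mem_nhdsWithin_iff.2 ⟨r, hr, subset_rfl⟩
  have ho : IsOpen (Metric.ball a r \ {a}) := Metric.isOpen_ball.sdiff isClosed_singleton
  refine ⟨L, ?_, ?_⟩
  · filter_upwards [hm] with z hz using hL.continuousAt (ho.mem_nhds hz)
  · filter_upwards [hm] with z hz using hF z hz

theorem HasLocalIndex.eventually_ne_zero {F : ℂ → ℂ} {a : ℂ} {n : ℤ} (h : HasLocalIndex F a n) :
    ∀ᶠ z in 𝓝[≠] a, F z ≠ 0 := by
  obtain ⟨L, -, hF⟩ := h.eventually
  filter_upwards [hF, self_mem_nhdsWithin] with z hz hza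
  rw [hz]
  exact mul_ne_zero (zpow_ne_zero _ (sub_ne_zero.2 hza)) (Complex.exp_ne_zero _)

/-- A function with values in the disc about `w` through `0` has a continuous logarithm. -/
theorem hasLocalIndex_of_norm_sub_lt {F : ℂ → ℂ} {a w : ℂ} {n : ℤ} {G : ℂ → ℂ}
    (hG : ∀ᶠ z in 𝓝[≠] a, ContinuousAt G z) (hw : ∀ᶠ z in 𝓝[≠] a, ‖G z - w‖ < ‖w‖)
    (hF : ∀ᶠ z in 𝓝[≠] a, F z = (z - a) ^ n * G z) : HasLocalIndex F a n := by
  obtain ⟨z₀, hz₀⟩ := hw.exists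
  have hw0 : w ≠ 0 := norm_pos_iff.1 ((norm_nonneg _).trans_lt hz₀)
  have hs : ∀ z, ‖G z - w‖ < ‖w‖ → G z / w ∈ Complex.slitPlane := by
    intro z hz
    left
    have h1 : ‖G z / w - 1‖ < 1 := by
      rw [div_sub_one hw0, norm_div]
      exact (div_lt_one (norm_pos_iff.2 hw0)).2 hz
    have := (abs_le.1 (Complex.abs_re_le_norm (G z / w - 1))).1
    simp only [Complex.sub_re, Complex.one_re] at this
    linarith
  refine hasLocalIndex_of_eventually (L := fun z => Complex.log w + Complex.log (G z / w)) ?_ ?_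
  · filter_upwards [hG, hw] with z h1 h2
    exact continuousAt_const.add ((h1.div_const w).clog (hs z h2))
  · filter_upwards [hF, hw] with z h1 h2
    rw [h1, Complex.exp_add, Complex.exp_log hw0,
      Complex.exp_log (Complex.slitPlane_ne_zero (hs z h2)), mul_div_cancel₀ _ hw0]

theorem HasLocalIndex.mul_of_continuous {F G H : ℂ → ℂ} {a : ℂ} {n : ℤ} (h : HasLocalIndex F a n)
    (hG : ∀ᶠ z in 𝓝 a, ContinuousAt G z) (hG0 : G a ≠ 0)
    (hH : ∀ᶠ z in 𝓝[≠] a, H z = F z * G z) : HasLocalIndex H a n := by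
  obtain ⟨L, hL, hF⟩ := h.eventually
  have h0 : HasLocalIndex G a 0 := by
    refine hasLocalIndex_of_norm_sub_lt (w := G a) (hG.filter_mono nhdsWithin_le_nhds) ?_
      (Eventually.of_forall fun z => by simp)
    have : Tendsto (fun z => ‖G z - G a‖) (𝓝 a) (𝓝 ‖G a - G a‖) :=
      (hG.self_of_nhds.sub continuousAt_const).norm
    rw [sub_self, norm_zero] at this
    exact (this.eventually (gt_mem_nhds (norm_pos_iff.2 hG0))).filter_mono nhdsWithin_le_nhds
  obtain ⟨M, hM, hGM⟩ := h0.eventually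
  refine hasLocalIndex_of_eventually (L := fun z => L z + M z) ?_ ?_
  · filter_upwards [hL, hM] with z h1 h2 using h1.add h2
  · filter_upwards [hF, hGM, hH] with z h1 h2 h3
    rw [h3, h1, h2, Complex.exp_add, zpow_zero, one_mul, mul_assoc]

/-- Induction on the singular points. A point `a` is removed by multiplying with (z - a)^{-n}
e^{-χL}, where χ is a cut-off that is 1 near `a` and 0 on `K`. The product is 1 near `a`, it keeps
its indices at the other points, and on `K` it differs from `F` only by (z - a)^{-n}. When no point
is left, the function has a logarithm because the plane is simply connected. -/
theorem exists_log_factorization (n : ℂ → ℤ) (S : Finset ℂ) : ∀ (F : ℂ → ℂ),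
    (∀ z ∉ S, ContinuousAt F z) → (∀ z ∉ S, F z ≠ 0) → (∀ a ∈ S, HasLocalIndex F a (n a)) →
    ∀ K : Set ℂ, IsClosed K → (∀ a ∈ S, a ∉ K) →
    ∃ l : ℂ → ℂ, Continuous l ∧
      ∀ z ∈ K, F z = (∏ a ∈ S, (z - a) ^ n a) * Complex.exp (l z) := by
  classical
  induction S using Finset.induction_on with
  | empty =>
    intro F hF hF0 _ K _ _
    obtain ⟨l, hl, hl'⟩ := exists_continuous_log (X := ℂ) (g := F)
      (continuous_iff_continuousAt.2 fun z => hF z (by simp)) (fun z => hF0 z (by simp))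
    exact ⟨l, hl, fun z _ => by simp [hl']⟩
  | insert a S ha ih =>
    intro F hF hF0 hloc K hK hKS
    obtain ⟨r, hr, L, hL, hFL⟩ := hloc a (Finset.mem_insert_self a S)
    have hopen : (K ∪ (S : Set ℂ))ᶜ ∈ 𝓝 a := by
      refine (hK.union S.finite_toSet.isClosed).isOpen_compl.mem_nhds ?_
      simp [ha, hKS a (Finset.mem_insert_self a S)]
    obtain ⟨ρ', hρ', hball⟩ := Metric.mem_nhds_iff.1 hopen
    obtain ⟨ρ, hρ0, hρ⟩ := exists_between (lt_min hr hρ')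
    have hfar : ∀ z, (z ∈ K ∨ z ∈ S) → ρ < ‖z - a‖ := by
      intro z hz
      by_contra hcon
      have : z ∈ Metric.ball a ρ' := by
        rw [mem_ball_iff_norm]
        exact (not_lt.1 hcon).trans_lt (hρ.trans_le (min_le_right _ _))
      exact hball this hz
    -- χ is 1 for ‖z - a‖ ≤ ρ/2 and 0 for ‖z - a‖ ≥ ρ. Since ρ < r, the product χL is continuous off
    -- `a` although `L` is controlled only inside the ball of radius r.
    set χ : ℂ → ℝ := fun z => max 0 (min 1 (2 - 2 * ‖z - a‖ / ρ)) with hχ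
    have hχc : Continuous χ := by fun_prop
    have hχ0 : ∀ z, ρ ≤ ‖z - a‖ → χ z = 0 := by
      intro z hz
      have : (1 : ℝ) ≤ ‖z - a‖ / ρ := (one_le_div hρ0).2 hz
      have h2 : 2 - 2 * ‖z - a‖ / ρ ≤ 0 := by rw [mul_div_assoc]; linarith
      exact max_eq_left ((min_le_right _ _).trans h2)
    have hχ1 : ∀ z, ‖z - a‖ < ρ / 2 → χ z = 1 := by
      intro z hz
      have : ‖z - a‖ / ρ ≤ 1 / 2 := by rw [div_le_iff₀ hρ0]; linarith
      have h2 : 1 ≤ 2 - 2 * ‖z - a‖ / ρ := by rw [mul_div_assoc]; linarith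
      simp only [hχ]
      rw [min_eq_left h2]
      exact max_eq_right zero_le_one
    have hχL : ∀ z, z ≠ a → ContinuousAt (fun z => (χ z : ℂ) * L z) z := by
      intro z hz
      by_cases hzr : ‖z - a‖ < r
      · have ho : IsOpen (Metric.ball a r \ {a}) := Metric.isOpen_ball.sdiff isClosed_singleton
        have : ContinuousAt L z :=
          hL.continuousAt (ho.mem_nhds ⟨mem_ball_iff_norm.2 hzr, hz⟩)
        exact (Complex.continuous_ofReal.comp hχc).continuousAt.mul this
      · have hlt : ρ < ‖z - a‖ := (hρ.trans_le (min_le_left _ _)).trans_le (not_lt.1 hzr)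
        have hev : ∀ᶠ y in 𝓝 z, ρ < ‖y - a‖ :=
          (continuous_id.sub continuous_const).norm.continuousAt.eventually (lt_mem_nhds hlt)
        refine (continuousAt_const (y := (0 : ℂ))).congr ?_
        filter_upwards [hev] with y hy
        simp [hχ0 y hy.le]
    set G : ℂ → ℂ := fun z => (z - a) ^ (-n a) * Complex.exp (-(χ z * L z)) with hG
    have hGc : ∀ z, z ≠ a → ContinuousAt G z := by
      intro z hz
      refine ContinuousAt.mul ?_ ?_
      · exact (continuousAt_id.sub continuousAt_const).zpow₀ _ (Or.inl (sub_ne_zero.2 hz))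
      · exact (hχL z hz).neg.cexp
    have hG0 : ∀ z, z ≠ a → G z ≠ 0 := fun z hz =>
      mul_ne_zero (zpow_ne_zero _ (sub_ne_zero.2 hz)) (Complex.exp_ne_zero _)
    -- The product is identically 1 on a punctured disc about `a`, so the value 1 makes it
    -- continuous there.
    set F₁ : ℂ → ℂ := Function.update (fun z => F z * G z) a 1 with hF₁
    have hF₁z : ∀ z, z ≠ a → F₁ z = F z * G z := fun z hz => Function.update_of_ne hz _ _
    have hF₁ev : ∀ z, z ≠ a → F₁ =ᶠ[𝓝 z] fun z => F z * G z := fun z hz => by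
      filter_upwards [isOpen_ne.mem_nhds hz] with y hy using hF₁z y hy
    have hc₁ : ∀ z ∉ S, ContinuousAt F₁ z := by
      intro z hz
      by_cases hza : z = a
      · subst hza
        refine (continuousAt_const (y := (1 : ℂ))).congr ?_
        filter_upwards [Metric.ball_mem_nhds z (half_pos hρ0)] with y hy
        by_cases hya : y = z
        · rw [hya, hF₁, Function.update_self]
        · have hy' : ‖y - z‖ < ρ / 2 := mem_ball_iff_norm.1 hy
          have hyr : ‖y - z‖ < r := by
            have := hρ.trans_le (min_le_left _ _)
            linarith
          rw [hF₁z y hya, hFL y ⟨mem_ball_iff_norm.2 hyr, hya⟩]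
          simp only [hG, hχ1 y hy', Complex.ofReal_one, one_mul, zpow_neg, Complex.exp_neg]
          have := zpow_ne_zero (n z) (sub_ne_zero.2 hya)
          have := Complex.exp_ne_zero (L y)
          field_simp
      · exact ((hF z (by simp [hza, hz])).mul (hGc z hza)).congr (hF₁ev z hza).symm
    have hn₁ : ∀ z ∉ S, F₁ z ≠ 0 := by
      intro z hz
      by_cases hza : z = a
      · rw [hza, hF₁, Function.update_self]; exact one_ne_zero
      · rw [hF₁z z hza]
        exact mul_ne_zero (hF0 z (by simp [hza, hz])) (hG0 z hza)
    have hi₁ : ∀ b ∈ S, HasLocalIndex F₁ b (n b) := by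
      intro b hb
      have hba : b ≠ a := fun h => ha (h ▸ hb)
      refine (hloc b (Finset.mem_insert_of_mem hb)).mul_of_continuous (G := G) ?_ (hG0 b hba)
        ((hF₁ev b hba).filter_mono nhdsWithin_le_nhds)
      filter_upwards [isOpen_ne.mem_nhds hba] with y hy using hGc y hy
    obtain ⟨l, hl, hl'⟩ := ih F₁ hc₁ hn₁ hi₁ K hK fun b hb => hKS b (Finset.mem_insert_of_mem hb)
    refine ⟨l, hl, fun z hz => ?_⟩
    have hza : z ≠ a := fun h => hKS a (Finset.mem_insert_self a S) (h ▸ hz)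
    have h1 := hl' z hz
    rw [hF₁z z hza] at h1
    simp only [hG, hχ0 z (hfar z (Or.inl hz)).le] at h1
    rw [Finset.prod_insert ha, mul_assoc, ← h1]
    have := zpow_ne_zero (n a) (sub_ne_zero.2 hza)
    simp only [Complex.ofReal_zero, zero_mul, neg_zero, Complex.exp_zero, mul_one, zpow_neg]
    field_simp

/-- The argument change of `F` along a closed curve, from the local indices of `F`. -/
theorem argChange_comp_eq_sum {F : ℂ → ℂ} {n : ℂ → ℤ} {S : Finset ℂ} {K : Set ℂ} {l : ℂ → ℂ}
    (hl : Continuous l) (hF : ∀ z ∈ K, F z = (∏ a ∈ S, (z - a) ^ n a) * Complex.exp (l z))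
    (hKS : ∀ a ∈ S, a ∉ K) {c : ℝ → ℂ} {s t : ℝ} (hst : s ≤ t) (hc : ContinuousOn c (Icc s t))
    (hcK : ∀ x ∈ Icc s t, c x ∈ K) (hclosed : c s = c t) :
    argChange (fun x => F (c x)) s t = ∑ a ∈ S, n a * argChange (fun x => c x - a) s t := by
  refine argChange_prod_zpow_mul_exp S n (fun a x => c x - a) hst
    (fun a _ => hc.sub continuousOn_const) (fun a ha x hx h => ?_)
    (l := fun x => l (c x)) (hl.comp_continuousOn hc) (by rw [hclosed])
    fun x hx => hF _ (hcK x hx)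
  exact hKS a ha (sub_eq_zero.1 h ▸ hcK x hx)

/-- R e^{-it} - a = e^{-it} (R - e^{it} a), and the second factor does not turn because `R`
dominates. -/
theorem argChange_circle_neg {a : ℂ} {R : ℝ} (hR : ‖a‖ < R) :
    argChange (fun t => R * Complex.exp (-(t * Complex.I)) - a) 0 (2 * Real.pi) = -1 := by
  have hR0 : (R : ℂ) ≠ 0 := by exact_mod_cast ((norm_nonneg a).trans_lt hR).ne'
  have h1 := argChange_sub_exp_eq_zero (p := (R : ℂ)) (q := a)
    (by rwa [Complex.norm_real, Real.norm_of_nonneg ((norm_nonneg a).trans hR.le)])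
  have h2 := argChange_prod_zpow_mul_exp (Finset.univ : Finset (Fin 2)) ![1, -1]
    ![fun t => R - Complex.exp (t * Complex.I) * a, fun t => Complex.exp (t * Complex.I)]
    (F := fun t => R * Complex.exp (-(t * Complex.I)) - a) (a := 0) (b := 2 * Real.pi)
    Real.two_pi_pos.le (l := 0)
  rw [h2]
  · have h3 : argChange (fun t => Complex.exp (t * Complex.I)) 0 (2 * Real.pi) = 1 := by
      have := argChange_sub_exp_eq_one (p := 0) (q := -1) (by simp)
      simpa using this
    simp [h1, h3]
  · intro i _
    fin_cases i <;> simp <;> fun_prop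
  · intro i _ t _
    fin_cases i
    · simp only [Fin.zero_eta, Matrix.cons_val_zero]
      intro h
      have := congrArg norm (sub_eq_zero.1 h)
      rw [norm_mul, Complex.norm_exp_ofReal_mul_I, one_mul, Complex.norm_real,
        Real.norm_of_nonneg ((norm_nonneg a).trans hR.le)] at this
      exact hR.ne' this
    · simp
  · exact continuousOn_const
  · rfl
  · intro t _
    have := Complex.exp_ne_zero (t * Complex.I)
    simp [Complex.exp_neg]
    field_simp

/-- Every point of `S` lies inside the large circles, which run clockwise and so wind -1 times about
it. -/
theorem indexInfty_eq {F : ℂ → ℂ} {n : ℂ → ℤ} {S : Finset ℂ} {K : Set ℂ} {l : ℂ → ℂ}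
    (hl : Continuous l) (hF : ∀ z ∈ K, F z = (∏ a ∈ S, (z - a) ^ n a) * Complex.exp (l z))
    {R₀ : ℝ} (hK : ∀ z, R₀ ≤ ‖z‖ → z ∈ K) (hKS : ∀ a ∈ S, a ∉ K) :
    indexInfty F = -∑ a ∈ S, (n a : ℝ) := by
  refine Tendsto.limUnder_eq (tendsto_const_nhds.congr' ?_)
  filter_upwards [eventually_ge_atTop R₀, eventually_ge_atTop 0] with R hR hR0
  have hn : ∀ t : ℝ, ‖(R : ℂ) * Complex.exp (-(t * Complex.I))‖ = R := by
    intro t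
    have e : -((t : ℂ) * Complex.I) = ((-t : ℝ) : ℂ) * Complex.I := by push_cast; ring
    rw [norm_mul, e, Complex.norm_exp_ofReal_mul_I, mul_one, Complex.norm_real,
      Real.norm_of_nonneg hR0]
  rw [argChange_comp_eq_sum hl hF hKS Real.two_pi_pos.le (by fun_prop)
    (fun t _ => hK _ (by rw [hn]; exact hR))
    (by simp [Complex.exp_neg, Complex.exp_two_pi_mul_I]), ← Finset.sum_neg_distrib]
  refine Finset.sum_congr rfl fun a ha => ?_
  rw [argChange_circle_neg, mul_neg_one]
  by_contra hcon
  exact hKS a ha (hK a (hR.trans (not_lt.1 hcon)))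

/-! ### Continuous choice of the roots of a monic polynomial -/

/-- The coordinates of `z` are the zeros, with multiplicities, of the monic polynomial `q`. -/
def IsRootVector {d : ℕ} (q : ℂ → ℂ) (z : Fin d → ℂ) : Prop := ∀ x, ∏ j, (x - z j) = q x

theorem exists_perm_comp_eq_of_map_eq {α β : Type*} [Fintype α] {z y : α → β}
    (h : Multiset.map z Finset.univ.val = Multiset.map y Finset.univ.val) :
    ∃ σ : Equiv.Perm α, y ∘ σ = z := by
  classical
  have hcard : ∀ c, Nonempty ({j // z j = c} ≃ {j // y j = c}) := by
    intro c
    refine ⟨Fintype.equivOfCardEq ?_⟩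
    have := congrArg (Multiset.count c) h
    rw [Multiset.count_map, Multiset.count_map] at this
    rw [Fintype.card_subtype, Fintype.card_subtype]
    simpa [Finset.card_def, eq_comm] using this
  refine ⟨(Equiv.sigmaFiberEquiv z).symm.trans
    ((Equiv.sigmaCongrRight fun c => Classical.choice (hcard c)).trans
      (Equiv.sigmaFiberEquiv y)), ?_⟩
  funext j
  exact (Classical.choice (hcard (z j)) ⟨j, rfl⟩).2

theorem IsRootVector.exists_perm {d : ℕ} {q : ℂ → ℂ} {z y : Fin d → ℂ} (hz : IsRootVector q z)
    (hy : IsRootVector q y) : ∃ σ : Equiv.Perm (Fin d), y ∘ σ = z := by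
  refine exists_perm_comp_eq_of_map_eq ?_
  have h : ∏ j, (Polynomial.X - Polynomial.C (z j)) =
      ∏ j, (Polynomial.X - Polynomial.C (y j)) := by
    refine Polynomial.funext fun x => ?_
    simp only [Polynomial.eval_prod, Polynomial.eval_sub, Polynomial.eval_X, Polynomial.eval_C]
    rw [hz x, hy x]
  have hr : ∀ w : Fin d → ℂ, (∏ j, (Polynomial.X - Polynomial.C (w j))).roots =
      Multiset.map w Finset.univ.val := by
    intro w
    rw [← Polynomial.roots_multiset_prod_X_sub_C (Multiset.map w Finset.univ.val),
      Multiset.map_map]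
    rfl
  rw [← hr z, ← hr y, h]

theorem IsRootVector.comp_perm {d : ℕ} {q : ℂ → ℂ} {z : Fin d → ℂ} (hz : IsRootVector q z)
    (σ : Equiv.Perm (Fin d)) : IsRootVector q (z ∘ σ) := fun x => by
  rw [← hz x]
  exact Equiv.prod_comp σ fun j => x - z j

theorem IsRootVector.of_tendsto {ι : Type*} {d : ℕ} {q : ℝ → ℂ → ℂ}
    (hq : ∀ x, Continuous fun t => q t x) {l : Filter ι} [l.NeBot] {s : ι → ℝ}
    {z : ι → Fin d → ℂ} {s₀ : ℝ} {z₀ : Fin d → ℂ} (hs : Tendsto s l (𝓝 s₀))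
    (hz : Tendsto z l (𝓝 z₀)) (h : ∀ᶠ i in l, IsRootVector (q (s i)) (z i)) :
    IsRootVector (q s₀) z₀ := by
  intro x
  have h1 : Tendsto (fun i => ∏ j, (x - z i j)) l (𝓝 (∏ j, (x - z₀ j))) :=
    tendsto_finsetProd _ fun j _ => tendsto_const_nhds.sub ((tendsto_pi_nhds.1 hz) j)
  have h2 : Tendsto (fun i => q (s i) x) l (𝓝 (q s₀ x)) := ((hq x).tendsto s₀).comp hs
  refine tendsto_nhds_unique h1 (h2.congr' ?_)
  filter_upwards [h] with i hi using (hi x).symm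

/-- One fixed ultrafilter replaces the passage to subsequences. It serves all sequences at once, so
limits can be taken simultaneously for uncountably many parameters. -/
theorem exists_tendsto_hyperfilter {E : Type*} [TopologicalSpace E] {K : Set E}
    (hK : IsCompact K) {x : ℕ → E} (hx : ∀ n, x n ∈ K) :
    ∃ y ∈ K, Tendsto x (hyperfilter ℕ : Filter ℕ) (𝓝 y) := by
  obtain ⟨y, hy, h⟩ := hK.ultrafilter_le_nhds' ((hyperfilter ℕ).map x)
    (Ultrafilter.mem_map.2 (Filter.univ_mem' hx))
  exact ⟨y, hy, h⟩

theorem exists_tendsto_rootVector {d : ℕ} {q : ℝ → ℂ → ℂ} {M : ℝ}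
    (hM : ∀ t, ∀ z : Fin d → ℂ, IsRootVector (q t) z → ∀ j, ‖z j‖ ≤ M)
    {s : ℕ → ℝ} {z : ℕ → Fin d → ℂ} (h : ∀ n, IsRootVector (q (s n)) (z n)) :
    ∃ z₀, Tendsto z (hyperfilter ℕ : Filter ℕ) (𝓝 z₀) := by
  have hK : IsCompact (Set.univ.pi fun _ : Fin d => Metric.closedBall (0 : ℂ) M) :=
    isCompact_univ_pi fun _ => isCompact_closedBall _ _
  obtain ⟨z₀, -, hz₀⟩ := exists_tendsto_hyperfilter hK (x := z) fun n j _ => by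
    simpa using hM _ _ (h n) j
  exact ⟨z₀, hz₀⟩

/-- The zeros depend uniformly continuously on the parameter, up to their numbering. -/
theorem exists_rootVector_dist_lt {d : ℕ} {q : ℝ → ℂ → ℂ} (hq : ∀ x, Continuous fun t => q t x)
    {M : ℝ} (hM : ∀ t, ∀ z : Fin d → ℂ, IsRootVector (q t) z → ∀ j, ‖z j‖ ≤ M)
    (hex : ∀ t, ∃ z : Fin d → ℂ, IsRootVector (q t) z) (T : ℝ) {ε : ℝ} (hε : 0 < ε) :
    ∃ δ > 0, ∀ s ∈ Icc 0 T, ∀ t ∈ Icc 0 T, |s - t| < δ → ∀ z : Fin d → ℂ, IsRootVector (q s) z →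
      ∃ y : Fin d → ℂ, IsRootVector (q t) y ∧ dist z y < ε := by
  -- Otherwise there are root vectors at parameters closer than 1/(n+1) which stay ε apart in every
  -- numbering. Their limits belong to the same polynomial, hence agree up to a permutation.
  by_contra! hcon
  have hpos : ∀ n : ℕ, (0 : ℝ) < 1 / ((n : ℝ) + 1) := fun n => Nat.one_div_pos_of_nat
  choose s hs t ht hst z hz hzy using fun n : ℕ => hcon _ (hpos n)
  choose y hy using fun n => hex (t n)
  have hle : (hyperfilter ℕ : Filter ℕ) ≤ atTop := Nat.hyperfilter_le_atTop
  obtain ⟨s₀, -, hs₀⟩ := exists_tendsto_hyperfilter isCompact_Icc hs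
  obtain ⟨z₀, hz₀⟩ := exists_tendsto_rootVector hM hz
  obtain ⟨y₀, hy₀⟩ := exists_tendsto_rootVector hM hy
  have ht₀ : Tendsto t (hyperfilter ℕ : Filter ℕ) (𝓝 s₀) := by
    have h0 : Tendsto (fun n => s n - t n) (hyperfilter ℕ : Filter ℕ) (𝓝 0) :=
      squeeze_zero_norm (fun n => (hst n).le)
        (tendsto_one_div_add_atTop_nhds_zero_nat.mono_left hle)
    simpa using hs₀.sub h0
  have hR := IsRootVector.of_tendsto hq hs₀ hz₀ (Eventually.of_forall hz)
  obtain ⟨σ, hσ⟩ := hR.exists_perm (IsRootVector.of_tendsto hq ht₀ hy₀ (Eventually.of_forall hy))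
  have hyσ : Tendsto (fun n => y n ∘ σ) (hyperfilter ℕ : Filter ℕ) (𝓝 z₀) := by
    rw [← hσ]
    exact tendsto_pi_nhds.2 fun j => tendsto_pi_nhds.1 hy₀ (σ j)
  have hd := hz₀.dist hyσ
  rw [dist_self] at hd
  obtain ⟨n, hn⟩ := (hd.eventually (gt_mem_nhds hε)).exists
  exact absurd hn (not_lt.2 (hzy n _ ((hy n).comp_perm σ)))

theorem exists_chain_of_step {E : Type*} {R : ℕ → E → Prop} {Q : E → E → Prop}
    (h0 : ∃ z, R 0 z) (hstep : ∀ k z, R k z → ∃ y, R (k + 1) y ∧ Q z y) :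
    ∃ Z : ℕ → E, (∀ k, R k (Z k)) ∧ ∀ k, Q (Z k) (Z (k + 1)) := by
  choose g hg hg' using hstep
  let Z : ∀ k, {z // R k z} := fun k =>
    Nat.rec ⟨h0.choose, h0.choose_spec⟩ (fun k z => ⟨g k z.1 z.2, hg k z.1 z.2⟩) k
  exact ⟨fun k => (Z k).1, fun k => (Z k).2, fun k => hg' k (Z k).1 (Z k).2⟩

/-- A chain with short steps that stays near a finite separated set stays near one point. -/
theorem dist_chain_lt {ι : Type*} {d : ℕ} {Z : ℕ → Fin d → ℂ} {r : ι → ℂ} {η : ℝ}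
    (hsep : ∀ i j, r i ≠ r j → 4 * η ≤ dist (r i) (r j))
    (hstep : ∀ k, dist (Z k) (Z (k + 1)) < η) {a b : ℕ} (hab : a ≤ b)
    (hnear : ∀ k ∈ Icc a b, ∀ j, ∃ i, dist (Z k j) (r i) < η) (j : Fin d) :
    dist (Z a j) (Z b j) < 2 * η := by
  obtain ⟨i, hi⟩ := hnear a (left_mem_Icc.2 hab) j
  have key : ∀ k, a ≤ k → k ≤ b → dist (Z k j) (r i) < η := by
    intro k hk
    induction k, hk using Nat.le_induction with
    | base => exact fun _ => hi
    | succ k hk ih =>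
      intro hkb
      have h1 := ih (by omega)
      obtain ⟨i', hi'⟩ := hnear (k + 1) ⟨by omega, hkb⟩ j
      have h2 : dist (Z k j) (Z (k + 1) j) < η := (dist_le_pi_dist _ _ j).trans_lt (hstep k)
      -- If the nearby point changed, the old and the new one would be less than 3η apart.
      have h3 : r i = r i' := by
        by_contra hne
        have h4 := hsep i i' hne
        have h5 := dist_triangle4 (r i) (Z k j) (Z (k + 1) j) (r i')
        rw [dist_comm (r i) (Z k j)] at h5
        linarith [dist_nonneg.trans_lt hi]
      rw [h3]
      exact hi'
  have h1 := key b hab le_rfl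
  rw [dist_comm] at h1
  linarith [dist_triangle (Z a j) (r i) (Z b j)]

theorem exists_separation {ι : Type*} [Finite ι] (r : ι → ℂ) {ε : ℝ} (hε : 0 < ε) :
    ∃ η, 0 < η ∧ η ≤ ε ∧ ∀ i j, r i ≠ r j → 4 * η ≤ dist (r i) (r j) := by
  have : ∃ η ∈ Ioc 0 ε, ∀ p : ι × ι, r p.1 ≠ r p.2 → 4 * η ≤ dist (r p.1) (r p.2) := by
    have h : ∀ p : ι × ι, ∀ᶠ η in 𝓝[>] (0 : ℝ), r p.1 ≠ r p.2 →
        4 * η ≤ dist (r p.1) (r p.2) := by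
      intro p
      by_cases hp : r p.1 = r p.2
      · exact Eventually.of_forall fun η h => absurd hp h
      · have : 0 < dist (r p.1) (r p.2) / 4 := by have := dist_pos.2 hp; positivity
        filter_upwards [Ioo_mem_nhdsGT this] with η hη _
        linarith [hη.2]
    obtain ⟨η, h1, h2⟩ := ((eventually_all.2 h).and (Ioc_mem_nhdsGT hε)).exists
    exact ⟨η, h2, h1⟩
  obtain ⟨η, h1, h2⟩ := this
  exact ⟨η, h1.1, h1.2, fun i j h => h2 (i, j) h⟩

/-- The zeros of a monic polynomial depending continuously on a real parameter can be chosen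
continuously. -/
theorem exists_continuousOn_rootVector {d : ℕ} {q : ℝ → ℂ → ℂ}
    (hq : ∀ x, Continuous fun t => q t x)
    {M : ℝ} (hM : ∀ t, ∀ z : Fin d → ℂ, IsRootVector (q t) z → ∀ j, ‖z j‖ ≤ M)
    (hex : ∀ t, ∃ z : Fin d → ℂ, IsRootVector (q t) z) {T : ℝ} (hT : 0 ≤ T) :
    ∃ z : ℝ → Fin d → ℂ, ContinuousOn z (Icc 0 T) ∧ ∀ t ∈ Icc 0 T, IsRootVector (q t) (z t) := by
  have hpos : ∀ n : ℕ, (0 : ℝ) < 1 / ((n : ℝ) + 1) := fun n => Nat.one_div_pos_of_nat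
  choose δ hδ hδ' using fun n : ℕ => exists_rootVector_dist_lt hq hM hex T (hpos n)
  -- Mesh of the n-th grid on [0, T]: below `δ n`, so that consecutive root vectors can be matched
  -- within 1/(n+1), and tending to 0.
  let h : ℕ → ℝ := fun n => min (δ n / 2) (1 / ((n : ℝ) + 1))
  have hh0 : ∀ n, 0 < h n := fun n => lt_min (half_pos (hδ n)) (hpos n)
  let τ : ℕ → ℕ → ℝ := fun n k => min (k * h n) T
  have hτ : ∀ n k, τ n k ∈ Icc 0 T := fun n k =>
    ⟨le_min (mul_nonneg k.cast_nonneg (hh0 n).le) hT, min_le_right _ _⟩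
  have hτstep : ∀ n k, |τ n k - τ n (k + 1)| < δ n := by
    intro n k
    have h1 : |τ n k - τ n (k + 1)| ≤ max |(k * h n - (k + 1 : ℕ) * h n)| |T - T| :=
      abs_min_sub_min_le_max _ _ _ _
    have h2 : |(k * h n - (k + 1 : ℕ) * h n)| = h n := by
      rw [show (k * h n - (k + 1 : ℕ) * h n) = -h n by push_cast; ring, abs_neg,
        abs_of_pos (hh0 n)]
    rw [h2, sub_self, abs_zero, max_eq_left (hh0 n).le] at h1
    have h3 : h n ≤ δ n / 2 := min_le_left _ _
    linarith [hδ n]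
  have hchain : ∀ n, ∃ Z : ℕ → Fin d → ℂ, (∀ k, IsRootVector (q (τ n k)) (Z k)) ∧
      ∀ k, dist (Z k) (Z (k + 1)) < 1 / ((n : ℝ) + 1) := fun n =>
    exists_chain_of_step (hex _) fun k z hz => hδ' n _ (hτ n k) _ (hτ n (k + 1)) (hτstep n k) z hz
  choose Z hZ hZstep using hchain
  let κ : ℕ → ℝ → ℕ := fun n t => ⌊t / h n⌋₊
  have hτκ : ∀ n, ∀ t ∈ Icc 0 T, τ n (κ n t) ∈ Icc (t - h n) t := by
    intro n t ht
    have h1 : (κ n t : ℝ) ≤ t / h n := Nat.floor_le (div_nonneg ht.1 (hh0 n).le)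
    have h2 : t / h n < κ n t + 1 := Nat.lt_floor_add_one _
    rw [le_div_iff₀ (hh0 n)] at h1
    rw [div_lt_iff₀ (hh0 n)] at h2
    have : τ n (κ n t) = κ n t * h n := min_eq_left (h1.trans ht.2)
    rw [this]
    exact ⟨by linarith, h1⟩
  have hle : (hyperfilter ℕ : Filter ℕ) ≤ atTop := Nat.hyperfilter_le_atTop
  have hsmall : ∀ c : ℝ, 0 < c → ∀ᶠ n : ℕ in (hyperfilter ℕ : Filter ℕ), 1 / ((n : ℝ) + 1) < c :=
    fun c hc => (tendsto_one_div_add_atTop_nhds_zero_nat.eventually (gt_mem_nhds hc)).filter_mono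
      hle
  -- The roots at `t` are the ultrafilter limit of the n-th chain at its last grid point not
  -- exceeding `t`.
  choose z hz using fun t : ℝ =>
    exists_tendsto_rootVector hM (s := fun n => τ n (κ n t)) fun n => hZ n (κ n t)
  have hroot : ∀ t ∈ Icc 0 T, IsRootVector (q t) (z t) := by
    intro t ht
    refine IsRootVector.of_tendsto hq ?_ (hz t) (Eventually.of_forall fun n => hZ n (κ n t))
    have h0 : Tendsto (fun n => τ n (κ n t) - t) (hyperfilter ℕ : Filter ℕ) (𝓝 0) := by
      refine squeeze_zero_norm (fun n => ?_)
        (tendsto_one_div_add_atTop_nhds_zero_nat.mono_left hle)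
      have h1 := hτκ n t ht
      rw [Real.norm_eq_abs, abs_le]
      have h2 : h n ≤ 1 / ((n : ℝ) + 1) := min_le_right _ _
      have h3 := hpos n
      constructor <;> linarith [h1.1, h1.2]
    simpa using h0.add_const t
  refine ⟨z, fun t₀ ht₀ => ?_, hroot⟩
  -- For parameters near `t₀` all roots lie within η of the roots at `t₀`, and distinct ones among
  -- these are at least 4η apart. A chain with steps below η cannot change clusters between `t` and
  -- `t₀`, so in the limit its ends differ by at most 2η < ε.
  rw [Metric.continuousWithinAt_iff]
  intro ε hε
  obtain ⟨η, hη0, hηε, hsep⟩ := exists_separation (z t₀) (show 0 < ε / 3 by positivity)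
  obtain ⟨δ₀, hδ₀, hnear⟩ := exists_rootVector_dist_lt hq hM hex T hη0
  refine ⟨δ₀ / 2, half_pos hδ₀, fun t ht htt₀ => ?_⟩
  have hnear' : ∀ s ∈ Icc 0 T, |s - t₀| < δ₀ → ∀ y : Fin d → ℂ, IsRootVector (q s) y →
      ∀ j, ∃ i, dist (y j) (z t₀ i) < η := by
    intro s hs hst y hy j
    obtain ⟨w, hw, hyw⟩ := hnear s hs t₀ ht₀ hst y hy
    obtain ⟨σ, hσ⟩ := hw.exists_perm (hroot t₀ ht₀)
    refine ⟨σ j, ?_⟩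
    rw [← hσ] at hyw
    exact (dist_le_pi_dist _ _ j).trans_lt hyw
  have hfin : ∀ᶠ n in (hyperfilter ℕ : Filter ℕ), ∀ j,
      dist (Z n (κ n t) j) (Z n (κ n t₀) j) < 2 * η := by
    filter_upwards [hsmall η hη0, hsmall (δ₀ / 2) (half_pos hδ₀)] with n hn hn'
    have hhn : h n ≤ 1 / ((n : ℝ) + 1) := min_le_right _ _
    have hτmono : Monotone (τ n) := fun a b hab =>
      min_le_min_right T (mul_le_mul_of_nonneg_right (by exact_mod_cast hab) (hh0 n).le)
    have habs := abs_lt.1 (Real.dist_eq t t₀ ▸ htt₀)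
    have h1 := hτκ n t ht
    have h2 := hτκ n t₀ ht₀
    rcases le_total (κ n t) (κ n t₀) with hk | hk
    · refine dist_chain_lt hsep (fun k => (hZstep n k).trans hn) hk fun k hk' =>
        hnear' _ (hτ n k) ?_ _ (hZ n k)
      have h3 := hτmono hk'.1
      have h4 := hτmono hk'.2
      rw [abs_lt]
      constructor <;> linarith [h1.1, h1.2, h2.1, h2.2]
    · intro j
      rw [dist_comm]
      refine dist_chain_lt hsep (fun k => (hZstep n k).trans hn) hk (fun k hk' =>
        hnear' _ (hτ n k) ?_ _ (hZ n k)) j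
      have h3 := hτmono hk'.1
      have h4 := hτmono hk'.2
      rw [abs_lt]
      constructor <;> linarith [h1.1, h1.2, h2.1, h2.2]
  have hlim : dist (z t) (z t₀) ≤ 2 * η := by
    refine (dist_pi_le_iff (by positivity)).2 fun j => ?_
    refine le_of_tendsto (((tendsto_pi_nhds.1 (hz t)) j).dist ((tendsto_pi_nhds.1 (hz t₀)) j)) ?_
    filter_upwards [hfin] with n hn using (hn j).le
  linarith

/-! ### The polynomials u - e^{it} v -/

open Polynomial in
/-- If `|u| < |v|` near infinity, then `|u / v| < 1` at infinity. -/
theorem natDegree_le_and_norm_coeff_lt {u v : ℂ[X]}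
    (h : ∀ᶠ z in Bornology.cobounded ℂ, ‖u.eval z‖ < ‖v.eval z‖) :
    u.natDegree ≤ v.natDegree ∧ ‖u.coeff v.natDegree‖ < ‖v.leadingCoeff‖ := by
  have hv0 : v ≠ 0 := by
    rintro rfl
    obtain ⟨z, hz⟩ := h.exists
    simp only [eval_zero, norm_zero] at hz
    exact absurd hz (not_lt.2 (norm_nonneg _))
  -- The substitution z = 1/ζ moves infinity to 0, where the reversed polynomials take the
  -- coefficients of degree `N` as values.
  have hinv : ∀ᶠ ζ in 𝓝[≠] (0 : ℂ), ‖u.eval ζ⁻¹‖ < ‖v.eval ζ⁻¹‖ :=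
    tendsto_inv₀_nhdsNE_zero.eventually h
  have hrefl : ∀ (p : ℂ[X]) (N : ℕ), p.natDegree ≤ N → ∀ ζ : ℂ, ζ ≠ 0 →
      (reflect N p).eval ζ = ζ ^ N * p.eval ζ⁻¹ := by
    intro p N hp ζ hζ
    have hi : ζ⁻¹ ≠ 0 := inv_ne_zero hζ
    let _ := invertibleOfNonzero hi
    have := eval₂_reflect_mul_pow (RingHom.id ℂ) ζ⁻¹ N p hp
    rw [invOf_eq_inv, inv_inv] at this
    simp only [eval₂_id] at this
    rw [← this, mul_comm, mul_assoc, ← mul_pow, inv_mul_cancel₀ hζ, one_pow, mul_one]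
  have hlt : ∀ N, u.natDegree ≤ N → v.natDegree ≤ N →
      ∀ᶠ ζ in 𝓝[≠] (0 : ℂ), ‖(reflect N u).eval ζ‖ < ‖(reflect N v).eval ζ‖ := by
    intro N hu hv
    filter_upwards [hinv, self_mem_nhdsWithin] with ζ h1 h2
    rw [hrefl u N hu ζ h2, hrefl v N hv ζ h2, norm_mul, norm_mul]
    exact mul_lt_mul_of_pos_left h1 (norm_pos_iff.2 (pow_ne_zero _ h2))
  have hlim : ∀ N, u.natDegree ≤ N → v.natDegree ≤ N → ‖u.coeff N‖ ≤ ‖v.coeff N‖ := by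
    intro N hu hv
    have h0 : ∀ p : ℂ[X], Tendsto (fun ζ => ‖(reflect N p).eval ζ‖) (𝓝[≠] 0) (𝓝 ‖p.coeff N‖) := by
      intro p
      have h1 : (reflect N p).eval 0 = p.coeff N := by
        rw [← coeff_zero_eq_eval_zero, coeff_reflect, revAt_le (Nat.zero_le N), Nat.sub_zero]
      rw [← h1]
      exact ((reflect N p).continuous.norm.tendsto 0).mono_left nhdsWithin_le_nhds
    exact le_of_tendsto_of_tendsto (h0 u) (h0 v) ((hlt N hu hv).mono fun _ h => h.le)
  have hdeg : u.natDegree ≤ v.natDegree := by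
    by_contra hcon
    have h1 := hlim u.natDegree le_rfl (not_le.1 hcon).le
    rw [coeff_eq_zero_of_natDegree_lt (not_le.1 hcon), norm_zero, norm_le_zero_iff] at h1
    have : u = 0 := leadingCoeff_eq_zero.1 h1
    simp [this] at hcon
  -- In case of equality, the quotient of the reversed polynomials has modulus 1 at 0 and less than
  -- 1 around it. By the maximum principle it is constant near 0, a contradiction.
  refine ⟨hdeg, lt_of_le_of_ne (hlim _ hdeg le_rfl) fun heq => ?_⟩
  set N := v.natDegree
  have hval : ∀ p : ℂ[X], (reflect N p).eval 0 = p.coeff N := by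
    intro p
    rw [← coeff_zero_eq_eval_zero, coeff_reflect, revAt_le (Nat.zero_le N), Nat.sub_zero]
  have hv' : (reflect N v).eval 0 ≠ 0 := by
    rw [hval]; exact leadingCoeff_ne_zero.2 hv0
  let w : ℂ → ℂ := fun ζ => (reflect N u).eval ζ / (reflect N v).eval ζ
  have hw0 : ‖w 0‖ = 1 := by
    simp only [w, norm_div, hval]
    rw [heq]
    exact div_self (norm_ne_zero_iff.2 (leadingCoeff_ne_zero.2 hv0))
  have hne : ∀ᶠ ζ in 𝓝 (0 : ℂ), (reflect N v).eval ζ ≠ 0 :=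
    (reflect N v).continuous.continuousAt.eventually_ne hv'
  have hw1 : ∀ᶠ ζ in 𝓝[≠] (0 : ℂ), ‖w ζ‖ < 1 := by
    filter_upwards [hlt N hdeg le_rfl, hne.filter_mono nhdsWithin_le_nhds] with ζ h1 h2
    rw [norm_div, div_lt_one (norm_pos_iff.2 h2)]
    exact h1
  have hmax : IsLocalMax (norm ∘ w) 0 := by
    have : ∀ᶠ ζ in 𝓝 (0 : ℂ), ζ ≠ 0 → ‖w ζ‖ < 1 := by
      simpa [eventually_nhdsWithin_iff] using hw1
    filter_upwards [this] with ζ h1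
    by_cases h2 : ζ = 0
    · rw [h2]
    · exact (h1 h2).le.trans hw0.ge
  have hconst := Complex.eventually_eq_of_isLocalMax_norm (f := w) (c := 0)
    (hne.mono fun ζ hζ => ((reflect N u).differentiable ζ).div ((reflect N v).differentiable ζ) hζ)
    hmax
  obtain ⟨ζ, h1, h2⟩ := (hw1.and (hconst.filter_mono nhdsWithin_le_nhds)).exists
  rw [h2, hw0] at h1
  exact lt_irrefl _ h1

/-- The monic polynomial with the zeros of `u - e^{it} v`. -/
noncomputable def levelPoly (u v : Polynomial ℂ) (t : ℝ) : Polynomial ℂ :=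
  Polynomial.C (u.coeff v.natDegree - Complex.exp (t * Complex.I) * v.leadingCoeff)⁻¹ *
    (u - Polynomial.C (Complex.exp (t * Complex.I)) * v)

section LevelPoly

variable {u v : Polynomial ℂ}

theorem sub_exp_mul_ne_zero {p q : ℂ} (h : ‖p‖ ≠ ‖q‖) (t : ℝ) :
    p - Complex.exp (t * Complex.I) * q ≠ 0 := by
  intro h0
  have := congrArg norm (sub_eq_zero.1 h0)
  rw [norm_mul, Complex.norm_exp_ofReal_mul_I, one_mul] at this
  exact h this

theorem eval_levelPoly (t : ℝ) (x : ℂ) : (levelPoly u v t).eval x =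
    (u.eval x - Complex.exp (t * Complex.I) * v.eval x) /
      (u.coeff v.natDegree - Complex.exp (t * Complex.I) * v.leadingCoeff) := by
  rw [levelPoly, Polynomial.eval_mul, Polynomial.eval_C, Polynomial.eval_sub, Polynomial.eval_mul,
    Polynomial.eval_C, inv_mul_eq_div]

theorem eval_levelPoly_eq_zero_iff (h : ‖u.coeff v.natDegree‖ < ‖v.leadingCoeff‖) (t : ℝ) (x : ℂ) :
    (levelPoly u v t).eval x = 0 ↔ u.eval x = Complex.exp (t * Complex.I) * v.eval x := by
  rw [eval_levelPoly, div_eq_zero_iff, sub_eq_zero,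
    or_iff_left (sub_exp_mul_ne_zero h.ne t)]

/-- The coefficient u_d - e^{it} v_d of degree d = deg v never vanishes, so no root escapes to
infinity as `t` varies. -/
theorem natDegree_levelPoly (hd : u.natDegree ≤ v.natDegree)
    (h : ‖u.coeff v.natDegree‖ < ‖v.leadingCoeff‖) (t : ℝ) :
    (levelPoly u v t).natDegree = v.natDegree ∧ (levelPoly u v t).Monic := by
  have hle : (levelPoly u v t).natDegree ≤ v.natDegree := by
    refine (Polynomial.natDegree_C_mul_le _ _).trans ((Polynomial.natDegree_sub_le _ _).trans ?_)
    exact max_le hd (Polynomial.natDegree_C_mul_le _ _)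
  have hc : (levelPoly u v t).coeff v.natDegree = 1 := by
    rw [levelPoly, Polynomial.coeff_C_mul, Polynomial.coeff_sub, Polynomial.coeff_C_mul]
    exact inv_mul_cancel₀ (sub_exp_mul_ne_zero h.ne t)
  have hdeg : (levelPoly u v t).natDegree = v.natDegree :=
    Polynomial.natDegree_eq_of_le_of_coeff_ne_zero hle (by rw [hc]; exact one_ne_zero)
  exact ⟨hdeg, by rw [Polynomial.Monic, Polynomial.leadingCoeff, hdeg, hc]⟩

theorem exists_isRootVector_of_monic {p : Polynomial ℂ} {d : ℕ} (hp : p.Monic)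
    (hd : p.natDegree = d) : ∃ z : Fin d → ℂ, IsRootVector p.eval z := by
  have hs : p.Splits := IsAlgClosed.splits p
  have hcard : p.roots.toList.length = d := by
    rw [Multiset.length_toList, ← hd, hs.natDegree_eq_card_roots]
  subst hcard
  refine ⟨p.roots.toList.get, fun x => ?_⟩
  have h1 := hs.eval_eq_prod_roots_of_monic hp x
  change _ = p.eval x
  rw [h1, ← List.prod_ofFn]
  conv_rhs => rw [← Multiset.coe_toList p.roots, Multiset.map_coe, Multiset.prod_coe]
  congr 1
  conv_rhs => rw [← List.ofFn_get p.roots.toList, List.map_ofFn]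
  rfl

theorem IsRootVector.exists_eq_iff {d : ℕ} {q : ℂ → ℂ} {z : Fin d → ℂ} (hz : IsRootVector q z)
    (x : ℂ) : (∃ j, z j = x) ↔ q x = 0 := by
  rw [← hz x, Finset.prod_eq_zero_iff]
  simp [sub_eq_zero, eq_comm]

/-- The zeros of `u - e^{it} v` at which the Wronskian of `u` and `v` does not vanish are
simple. -/
theorem IsRootVector.eq_of_wronskian_ne_zero
    (h : ‖u.coeff v.natDegree‖ < ‖v.leadingCoeff‖) {t : ℝ} {d : ℕ} {z : Fin d → ℂ}
    (hz : IsRootVector (levelPoly u v t).eval z) {i j : Fin d} (hij : z i = z j)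
    (hw : (u.derivative * v - u * v.derivative).eval (z i) ≠ 0) : i = j := by
  by_contra hne
  apply hw
  have hroot : (levelPoly u v t).eval (z i) = 0 := (hz.exists_eq_iff _).1 ⟨i, rfl⟩
  -- A repeated root gives a squared factor, so the derivative vanishes as well. Then u = e^{it} v
  -- and u' = e^{it} v' at this root, which annihilates the Wronskian.
  have hfac : levelPoly u v t = (Polynomial.X - Polynomial.C (z i)) ^ 2 *
      ∏ k ∈ (Finset.univ.erase i).erase j, (Polynomial.X - Polynomial.C (z k)) := by
    refine Polynomial.funext fun x => ?_
    have hzx : ∏ k, (x - z k) = (levelPoly u v t).eval x := hz x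
    rw [← hzx, ← Finset.mul_prod_erase _ _ (Finset.mem_univ i),
      ← Finset.mul_prod_erase (Finset.univ.erase i) _
        (Finset.mem_erase.2 ⟨Ne.symm hne, Finset.mem_univ j⟩), ← hij]
    simp only [Polynomial.eval_mul, Polynomial.eval_pow, Polynomial.eval_prod,
      Polynomial.eval_sub, Polynomial.eval_X, Polynomial.eval_C]
    ring
  have hder : (levelPoly u v t).derivative.eval (z i) = 0 := by
    rw [hfac]
    simp [Polynomial.derivative_mul, Polynomial.derivative_pow]
  have hder' : u.derivative.eval (z i) = Complex.exp (t * Complex.I) * v.derivative.eval (z i) := by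
    rw [levelPoly] at hder
    simp only [Polynomial.derivative_mul, Polynomial.derivative_C, zero_mul, zero_add,
      Polynomial.derivative_sub, Polynomial.eval_mul, Polynomial.eval_C,
      Polynomial.eval_sub] at hder
    exact sub_eq_zero.1
      ((mul_eq_zero.1 hder).resolve_left (inv_ne_zero (sub_exp_mul_ne_zero h.ne t)))
  have hval := (eval_levelPoly_eq_zero_iff h t (z i)).1 hroot
  rw [Polynomial.eval_sub, Polynomial.eval_mul, Polynomial.eval_mul, hder', hval]
  ring

end LevelPoly

/-! ### Monodromy: from cycles to closed curves -/

/-- Multiplication with a transposition of two points on different cycles merges these cycles: from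
`i` the new permutation runs through the old cycle of `j`, and from `j` it goes on to `σ i`. -/
theorem sameCycle_mul_swap {α : Type*} [DecidableEq α] [Finite α] {σ : Equiv.Perm α} {i j : α}
    (hij : ¬σ.SameCycle i j) : (σ * Equiv.swap i j).SameCycle i j ∧
      ∀ a b, σ.SameCycle a b → (σ * Equiv.swap i j).SameCycle a b := by
  set τ := σ * Equiv.swap i j with hτ
  have hi : τ i = σ j := by simp [hτ]
  have hj : τ j = σ i := by simp [hτ]
  have ho : ∀ a, a ≠ i → a ≠ j → τ a = σ a := fun a h1 h2 => by
    simp [hτ, Equiv.swap_apply_of_ne_of_ne h1 h2]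
  have hper : j ∈ Function.periodicPts σ := by
    refine ⟨orderOf σ, orderOf_pos σ, ?_⟩
    rw [Function.IsPeriodicPt, Function.IsFixedPt, Equiv.Perm.iterate_eq_pow, pow_orderOf_eq_one]
    rfl
  have hpos := Function.minimalPeriod_pos_of_mem_periodicPts hper
  have key : ∀ k, k < Function.minimalPeriod σ j → τ.SameCycle i (σ^[k + 1] j) := by
    intro k
    induction k with
    | zero =>
      intro _
      rw [Function.iterate_one, ← hi]
      exact (Equiv.Perm.SameCycle.refl τ i).apply_right
    | succ k ih =>
      intro hk
      have h1 := ih (by omega)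
      rw [Function.iterate_succ_apply', ← ho (σ^[k + 1] j)]
      · exact h1.apply_right
      · intro h
        have hs : σ.SameCycle j i :=
          ⟨((k + 1 : ℕ) : ℤ), by rw [zpow_natCast, ← Equiv.Perm.iterate_eq_pow, h]⟩
        exact hij hs.symm
      · intro h
        exact Function.not_isPeriodicPt_of_pos_of_lt_minimalPeriod (Nat.succ_ne_zero k) hk h
  have hij' : τ.SameCycle i j := by
    have := key (Function.minimalPeriod σ j - 1) (by omega)
    rwa [Nat.sub_add_cancel hpos, Function.iterate_minimalPeriod] at this
  have hstep : ∀ a, τ.SameCycle a (σ a) := by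
    intro a
    by_cases h1 : a = i
    · rw [h1, ← hj]; exact hij'.apply_right
    · by_cases h2 : a = j
      · rw [h2, ← hi]; exact hij'.symm.apply_right
      · rw [← ho a h1 h2]; exact (Equiv.Perm.SameCycle.refl τ a).apply_right
  refine ⟨hij', fun a b hab => ?_⟩
  obtain ⟨k, hk⟩ := hab.exists_nat_pow_eq
  rw [← hk]
  clear hk hab
  induction k with
  | zero => exact Equiv.Perm.SameCycle.refl τ a
  | succ k ih =>
    rw [pow_succ', Equiv.Perm.mul_apply]
    exact ih.trans (hstep _)

/-- Continuously chosen zeros on a period, numbered such that two of them meet only if they lie on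
the same cycle of the monodromy permutation. -/
theorem exists_rootVector_sameCycle {d : ℕ} {q : ℝ → ℂ → ℂ} (hq : ∀ x, Continuous fun t => q t x)
    {M : ℝ} (hM : ∀ t, ∀ z : Fin d → ℂ, IsRootVector (q t) z → ∀ j, ‖z j‖ ≤ M)
    (hex : ∀ t, ∃ z : Fin d → ℂ, IsRootVector (q t) z) {T : ℝ} (hT : 0 ≤ T) (hper : q T = q 0) :
    ∃ (z : ℝ → Fin d → ℂ) (σ : Equiv.Perm (Fin d)), ContinuousOn z (Icc 0 T) ∧
      (∀ t ∈ Icc 0 T, IsRootVector (q t) (z t)) ∧ z 0 ∘ σ = z T ∧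
      ∀ t ∈ Icc 0 T, ∀ i j, z t i = z t j → σ.SameCycle i j := by
  classical
  let V : (ℝ → Fin d → ℂ) → Equiv.Perm (Fin d) → Prop := fun z σ => ContinuousOn z (Icc 0 T) ∧
    (∀ t ∈ Icc 0 T, IsRootVector (q t) (z t)) ∧ z 0 ∘ σ = z T
  have hne : {σ | ∃ z, V z σ}.Nonempty := by
    obtain ⟨z, hz, hz'⟩ := exists_continuousOn_rootVector hq hM hex hT
    have h1 := hz' T (right_mem_Icc.2 hT)
    rw [hper] at h1
    obtain ⟨σ, hσ⟩ := h1.exists_perm (hz' 0 (left_mem_Icc.2 hT))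
    exact ⟨σ, z, hz, hz', hσ⟩
  -- Choose a continuous numbering whose permutation relates the most pairs. If roots on two
  -- different cycles met at `t₀`, exchanging their numbers from `t₀` on would keep continuity,
  -- merge the two cycles and relate more pairs.
  obtain ⟨σ, ⟨z, hzc, hzr, hzσ⟩, hmax⟩ := Set.exists_max_image {σ | ∃ z, V z σ}
    (fun σ => (Finset.univ.filter fun p : Fin d × Fin d => σ.SameCycle p.1 p.2).card)
    (Set.toFinite _) hne
  refine ⟨z, σ, hzc, hzr, hzσ, fun t₀ ht₀ i j hij => ?_⟩
  by_contra hcon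
  obtain ⟨h1, h2⟩ := sameCycle_mul_swap hcon
  have hswap : z t₀ ∘ Equiv.swap i j = z t₀ := by
    funext k
    simp only [Function.comp_apply, Equiv.swap_apply_def]
    split_ifs with h3 h4
    · rw [h3, hij]
    · rw [h4, hij]
    · rfl
  let z' : ℝ → Fin d → ℂ := fun t => if t < t₀ then z t else z t ∘ Equiv.swap i j
  have hz'1 : ∀ t ≤ t₀, z' t = z t := by
    intro t ht
    rcases ht.lt_or_eq with h | h
    · exact if_pos h
    · simp only [z', h, lt_irrefl, if_false, hswap]
  have hz'2 : ∀ t, t₀ ≤ t → z' t = z t ∘ Equiv.swap i j := fun t ht => if_neg (not_lt.2 ht)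
  have hV : V z' (σ * Equiv.swap i j) := by
    refine ⟨?_, fun t ht => ?_, ?_⟩
    · rw [← Icc_union_Icc_eq_Icc ht₀.1 ht₀.2]
      refine ContinuousOn.union_of_isClosed ?_ ?_ isClosed_Icc isClosed_Icc
      · exact (hzc.mono (Icc_subset_Icc_right ht₀.2)).congr fun t ht => hz'1 t ht.2
      · have : ContinuousOn (fun t => z t ∘ Equiv.swap i j) (Icc t₀ T) :=
          (continuous_pi fun k => continuous_apply (Equiv.swap i j k)).comp_continuousOn
            (hzc.mono (Icc_subset_Icc_left ht₀.1))
        exact this.congr fun t ht => hz'2 t ht.1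
    · rcases le_total t t₀ with h | h
      · rw [hz'1 t h]; exact hzr t ht
      · rw [hz'2 t h]; exact (hzr t ht).comp_perm _
    · rw [hz'1 0 ht₀.1, hz'2 T ht₀.2, ← hzσ]
      rfl
  refine absurd (hmax _ ⟨z', hV⟩) (not_le.2 (Finset.card_lt_card ?_))
  refine Finset.ssubset_iff_subset_ne.2 ⟨fun p hp => ?_, fun heq => ?_⟩
  · simp only [Finset.mem_filter, Finset.mem_univ, true_and] at hp ⊢
    exact h2 _ _ hp
  · have : (i, j) ∈ Finset.univ.filter fun p : Fin d × Fin d => σ.SameCycle p.1 p.2 := by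
      rw [heq]; simpa using h1
    exact hcon (by simpa using this)

/-- The path `z · i`, continued along the cycle of `i` under the monodromy permutation. -/
noncomputable def cyclePath {d : ℕ} (z : ℝ → Fin d → ℂ) (σ : Equiv.Perm (Fin d)) (T : ℝ) (i : Fin d)
    (t : ℝ) : ℂ := z (t - ⌊t / T⌋₊ * T) (σ^[⌊t / T⌋₊] i)

section CyclePath

variable {d : ℕ} {z : ℝ → Fin d → ℂ} {σ : Equiv.Perm (Fin d)} {T : ℝ}

/-- The case s = T is the seam: there the floor is already k + 1, and `z 0 ∘ σ = z T` makes both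
descriptions agree. -/
theorem cyclePath_add (hT : 0 < T) (hzσ : z 0 ∘ σ = z T) (i : Fin d) (k : ℕ) {s : ℝ}
    (hs : s ∈ Icc 0 T) : cyclePath z σ T i (s + k * T) = z s (σ^[k] i) := by
  have hdiv : (s + k * T) / T = s / T + k := by field_simp
  rcases hs.2.lt_or_eq with h | h
  · have hfl : ⌊(s + k * T) / T⌋₊ = k := by
      rw [hdiv, Nat.floor_add_natCast (div_nonneg hs.1 hT.le),
        Nat.floor_eq_zero.2 ((div_lt_one hT).2 h), zero_add]
    rw [cyclePath, hfl, add_sub_cancel_right]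
  · have hfl : ⌊(s + k * T) / T⌋₊ = k + 1 := by
      rw [hdiv, h, div_self hT.ne', Nat.floor_add_natCast zero_le_one, Nat.floor_one, add_comm]
    rw [cyclePath, hfl, h, Function.iterate_succ_apply', ← hzσ, Function.comp_apply]
    congr 1
    push_cast
    ring_nf

theorem exists_eq_add_mul (hT : 0 < T) {m : ℕ} {t : ℝ} (ht : t ∈ Ico 0 (m * T)) :
    ∃ k < m, ∃ s ∈ Ico 0 T, t = s + k * T := by
  have h1 : (⌊t / T⌋₊ : ℝ) ≤ t / T := Nat.floor_le (div_nonneg ht.1 hT.le)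
  have h2 : t / T < ⌊t / T⌋₊ + 1 := Nat.lt_floor_add_one _
  rw [le_div_iff₀ hT] at h1
  rw [div_lt_iff₀ hT] at h2
  refine ⟨⌊t / T⌋₊, ?_, t - ⌊t / T⌋₊ * T, ⟨by linarith, by linarith⟩, by ring⟩
  rw [Nat.floor_lt (div_nonneg ht.1 hT.le), div_lt_iff₀ hT]
  exact ht.2

theorem continuousOn_cyclePath (hT : 0 < T) (hzc : ContinuousOn z (Icc 0 T))
    (hzσ : z 0 ∘ σ = z T) (i : Fin d) (m : ℕ) :
    ContinuousOn (cyclePath z σ T i) (Icc 0 (m * T)) := by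
  induction m with
  | zero => simp
  | succ m ih =>
    have h1 : (0 : ℝ) ≤ m * T := by positivity
    have h2 : (m : ℝ) * T ≤ (m + 1 : ℕ) * T := by push_cast; linarith
    rw [← Icc_union_Icc_eq_Icc h1 h2]
    refine ih.union_of_isClosed ?_ isClosed_Icc isClosed_Icc
    have h3 : MapsTo (fun t => t - m * T) (Icc (m * T) ((m + 1 : ℕ) * T)) (Icc 0 T) := by
      intro t ht
      push_cast at ht
      exact ⟨by linarith [ht.1], by linarith [ht.2]⟩
    have h4 : ContinuousOn (fun t => z (t - m * T) (σ^[m] i)) (Icc (m * T) ((m + 1 : ℕ) * T)) :=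
      (continuous_apply (σ^[m] i)).comp_continuousOn (hzc.comp (by fun_prop) h3)
    refine h4.congr fun t ht => ?_
    have h5 := cyclePath_add hT hzσ i m (h3 ht)
    rwa [sub_add_cancel] at h5

theorem minimalPeriod_pos (σ : Equiv.Perm (Fin d)) (i : Fin d) :
    0 < Function.minimalPeriod σ i := by
  refine Function.minimalPeriod_pos_of_mem_periodicPts ⟨orderOf σ, orderOf_pos σ, ?_⟩
  rw [Function.IsPeriodicPt, Function.IsFixedPt, Equiv.Perm.iterate_eq_pow, pow_orderOf_eq_one]
  rfl

theorem cyclePath_closed (hT : 0 < T) (hzσ : z 0 ∘ σ = z T) (i : Fin d) :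
    cyclePath z σ T i 0 = cyclePath z σ T i (Function.minimalPeriod σ i * T) := by
  have h1 := cyclePath_add hT hzσ i 0 (left_mem_Icc.2 hT.le)
  have h2 := cyclePath_add hT hzσ i (Function.minimalPeriod σ i) (left_mem_Icc.2 hT.le)
  rw [Function.iterate_minimalPeriod] at h2
  simp only [Nat.cast_zero, zero_mul, add_zero, Function.iterate_zero, id_eq, zero_add] at h1 h2
  rw [h1, h2]

theorem image_cyclePath (hT : 0 < T) (hzσ : z 0 ∘ σ = z T) (i : Fin d) :
    cyclePath z σ T i '' Icc 0 (Function.minimalPeriod σ i * T) =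
      {x | ∃ s ∈ Icc 0 T, ∃ j, σ.SameCycle i j ∧ z s j = x} := by
  have hm := minimalPeriod_pos σ i
  set m := Function.minimalPeriod σ i with hmdef
  have hmT : (0 : ℝ) < m * T := mul_pos (by exact_mod_cast hm) hT
  ext x
  constructor
  · rintro ⟨t, ht, rfl⟩
    obtain ⟨t', ht', heq⟩ : ∃ t' ∈ Ico 0 (m * T), cyclePath z σ T i t = cyclePath z σ T i t' := by
      rcases ht.2.lt_or_eq with h | h
      · exact ⟨t, ⟨ht.1, h⟩, rfl⟩
      · exact ⟨0, ⟨le_rfl, hmT⟩, by rw [h, cyclePath_closed hT hzσ i]⟩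
    obtain ⟨k, -, s, hs, rfl⟩ := exists_eq_add_mul hT ht'
    refine ⟨s, Ico_subset_Icc_self hs, σ^[k] i, ⟨k, ?_⟩, ?_⟩
    · rw [zpow_natCast, Equiv.Perm.iterate_eq_pow]
    · rw [heq, cyclePath_add hT hzσ i k (Ico_subset_Icc_self hs)]
  · rintro ⟨s, hs, j, hj, rfl⟩
    obtain ⟨k, hk⟩ := hj.exists_nat_pow_eq
    rw [← Equiv.Perm.iterate_eq_pow, ← Function.iterate_mod_minimalPeriod_eq] at hk
    have hlt : k % m < m := Nat.mod_lt _ hm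
    refine ⟨s + (k % m : ℕ) * T, ⟨by have := hs.1; positivity, ?_⟩, ?_⟩
    · have h1 : (((k % m : ℕ) : ℝ) + 1) ≤ m := by exact_mod_cast hlt
      have h2 := mul_le_mul_of_nonneg_right h1 hT.le
      linarith [hs.2]
    · rw [cyclePath_add hT hzσ i _ hs, hk]

end CyclePath

/-! ### The components of the level set |u| = |v| -/

theorem exp_mul_I_injOn {s t : ℝ} (hs : s ∈ Ico 0 (2 * Real.pi)) (ht : t ∈ Ico 0 (2 * Real.pi))
    (h : Complex.exp (s * Complex.I) = Complex.exp (t * Complex.I)) : s = t := by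
  obtain ⟨n, hn⟩ := Complex.exp_eq_exp_iff_exists_int.1 h
  have h1 : s = t + n * (2 * Real.pi) := by
    have := congrArg Complex.im hn
    simpa using this
  have hpi := Real.two_pi_pos
  have h2 : (n : ℝ) < 1 := by
    by_contra hcon
    nlinarith [not_lt.1 hcon, hs.2, ht.1]
  have h3 : (-1 : ℝ) < n := by
    by_contra hcon
    nlinarith [not_lt.1 hcon, hs.1, ht.2]
  have h4 : n = 0 := by
    have h2' : n < 1 := by exact_mod_cast h2
    have h3' : -1 < n := by exact_mod_cast h3
    omega
  simpa [h4] using h1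

theorem exists_exp_mul_I_eq {w : ℂ} (hw : ‖w‖ = 1) :
    ∃ t ∈ Ico 0 (2 * Real.pi), Complex.exp (t * Complex.I) = w := by
  obtain ⟨θ, hθ⟩ := (Complex.norm_eq_one_iff w).1 hw
  refine ⟨toIcoMod Real.two_pi_pos 0 θ, by simpa using toIcoMod_mem_Ico Real.two_pi_pos 0 θ, ?_⟩
  rw [← hθ, Complex.exp_eq_exp_iff_exists_int]
  refine ⟨-toIcoDiv Real.two_pi_pos 0 θ, ?_⟩
  rw [toIcoMod, zsmul_eq_mul]
  push_cast
  ring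

theorem exp_add_natCast_mul (s : ℝ) (k : ℕ) :
    Complex.exp (((s + k * (2 * Real.pi) : ℝ) : ℂ) * Complex.I) = Complex.exp (s * Complex.I) := by
  rw [Complex.exp_eq_exp_iff_exists_int]
  refine ⟨k, ?_⟩
  push_cast
  ring

/-- The components of the level set `|u| = |v|` are finitely many closed curves. -/
theorem exists_curve_of_level_component {u v : Polynomial ℂ} (hcop : IsCoprime u v)
    (hinf : ∀ᶠ z in Bornology.cobounded ℂ, ‖u.eval z‖ < ‖v.eval z‖) :
    {Γ | ∃ z ∈ {z | ‖u.eval z‖ = ‖v.eval z‖},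
      Γ = connectedComponentIn {z | ‖u.eval z‖ = ‖v.eval z‖} z}.Finite ∧
    ∀ x₀ ∈ {z | ‖u.eval z‖ = ‖v.eval z‖}, ∃ γ : Curve, γ.toFun γ.a = γ.toFun γ.b ∧
      γ.toFun '' Icc γ.a γ.b = connectedComponentIn {z | ‖u.eval z‖ = ‖v.eval z‖} x₀ ∧
      (∀ t ∈ Icc γ.a γ.b,
        u.eval (γ.toFun t) = Complex.exp (t * Complex.I) * v.eval (γ.toFun t)) ∧
      ∀ z ∈ connectedComponentIn {z | ‖u.eval z‖ = ‖v.eval z‖} x₀,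
        (u.derivative * v - u * v.derivative).eval z ≠ 0 →
        ∃! t, t ∈ Ico γ.a γ.b ∧ γ.toFun t = z := by
  obtain ⟨hdeg, hlead⟩ := natDegree_le_and_norm_coeff_lt hinf
  set L := {z | ‖u.eval z‖ = ‖v.eval z‖} with hL
  set d := v.natDegree with hd
  have hpi := Real.two_pi_pos
  have hLv : ∀ x ∈ L, v.eval x ≠ 0 := by
    intro x hx hv
    have hu : u.eval x = 0 := by
      rw [← norm_eq_zero, show ‖u.eval x‖ = ‖v.eval x‖ from hx, hv, norm_zero]
    obtain ⟨a, b, hab⟩ := hcop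
    have := congrArg (Polynomial.eval x) hab
    simp [hu, hv] at this
  have hroot : ∀ t, ∀ z : Fin d → ℂ, IsRootVector (levelPoly u v t).eval z → ∀ j,
      u.eval (z j) = Complex.exp (t * Complex.I) * v.eval (z j) := fun t z hz j =>
    (eval_levelPoly_eq_zero_iff hlead t _).1 ((hz.exists_eq_iff _).1 ⟨j, rfl⟩)
  have hmemL : ∀ {t : ℝ} {x : ℂ}, u.eval x = Complex.exp (t * Complex.I) * v.eval x → x ∈ L := by
    intro t x hx
    change ‖u.eval x‖ = ‖v.eval x‖
    rw [hx, norm_mul, Complex.norm_exp_ofReal_mul_I, one_mul]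
  obtain ⟨M, hM⟩ : ∃ M, ∀ x ∈ L, ‖x‖ ≤ M := by
    have hb : Bornology.IsBounded L := by
      rw [Bornology.isBounded_def]
      filter_upwards [hinf] with z hz hzL using hz.ne hzL
    exact hb.exists_norm_le
  obtain ⟨z, σ, hzc, hzr, hzσ, hsame⟩ := exists_rootVector_sameCycle
    (q := fun t => (levelPoly u v t).eval) (d := d) (T := 2 * Real.pi)
    (fun x => by
      simp only [eval_levelPoly]
      exact Continuous.div (by fun_prop) (by fun_prop) fun t => sub_exp_mul_ne_zero hlead.ne t)
    (fun t z hz j => hM _ (hmemL (hroot t z hz j)))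
    (fun t => exists_isRootVector_of_monic (natDegree_levelPoly hdeg hlead t).2
      (natDegree_levelPoly hdeg hlead t).1) hpi.le
    (by
      funext x
      simp only [eval_levelPoly]
      simp)
  let E : Fin d → Set ℂ := fun i =>
    {x | ∃ s ∈ Icc 0 (2 * Real.pi), ∃ j, σ.SameCycle i j ∧ z s j = x}
  let c : Fin d → ℝ → ℂ := fun i => cyclePath z σ (2 * Real.pi) i
  let m : Fin d → ℕ := fun i => Function.minimalPeriod σ i
  have hm : ∀ i, (0 : ℝ) < m i * (2 * Real.pi) := fun i =>
    mul_pos (by exact_mod_cast minimalPeriod_pos σ i) hpi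
  have hE : ∀ i, c i '' Icc 0 (m i * (2 * Real.pi)) = E i := fun i => image_cyclePath hpi hzσ i
  have hc : ∀ i, ContinuousOn (c i) (Icc 0 (m i * (2 * Real.pi))) := fun i =>
    continuousOn_cyclePath hpi hzc hzσ i _
  have hEclosed : ∀ i, IsClosed (E i) := fun i => by
    rw [← hE]; exact (isCompact_Icc.image_of_continuousOn (hc i)).isClosed
  have hEconn : ∀ i, IsPreconnected (E i) := fun i => by
    rw [← hE]; exact isPreconnected_Icc.image _ (hc i)
  have hEL : ∀ i, E i ⊆ L := by
    rintro i x ⟨s, hs, j, -, rfl⟩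
    exact hmemL (hroot s _ (hzr s hs) j)
  have hcov : ∀ x ∈ L, ∃ i, x ∈ E i := by
    intro x hx
    obtain ⟨t, ht, hw⟩ := exists_exp_mul_I_eq (w := u.eval x / v.eval x) (by
      rw [norm_div, show ‖u.eval x‖ = ‖v.eval x‖ from hx]
      exact div_self (norm_ne_zero_iff.2 (hLv x hx)))
    have h0 : (levelPoly u v t).eval x = 0 := by
      rw [eval_levelPoly_eq_zero_iff hlead, hw, div_mul_cancel₀ _ (hLv x hx)]
    obtain ⟨j, hj⟩ := ((hzr t (Ico_subset_Icc_self ht)).exists_eq_iff x).2 h0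
    exact ⟨j, t, Ico_subset_Icc_self ht, j, Equiv.Perm.SameCycle.refl σ j, hj⟩
  have hdisj : ∀ i j x, x ∈ E i → x ∈ E j → σ.SameCycle i j := by
    rintro i j x ⟨s, hs, i', hi', rfl⟩ ⟨t, ht, j', hj', hx⟩
    -- A point of `L` determines its parameter modulo 2π through u/v. So s = t, or they are the two
    -- ends of the period, which `σ` identifies.
    have key : ∃ k, z s k = z s i' ∧ σ.SameCycle j k := by
      have e1 := hroot s _ (hzr s hs) i'
      have e2 := hroot t _ (hzr t ht) j'
      rw [hx, e1] at e2
      have e3 : Complex.exp (s * Complex.I) = Complex.exp (t * Complex.I) :=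
        mul_right_cancel₀ (hLv _ (hmemL e1)) e2
      have hend : ∀ r ∈ Icc (0 : ℝ) (2 * Real.pi), r ∈ Ico 0 (2 * Real.pi) ∨ r = 2 * Real.pi :=
        fun r hr => hr.2.lt_or_eq.imp (fun h => ⟨hr.1, h⟩) id
      have h2pi : Complex.exp ((2 * Real.pi : ℝ) * Complex.I) = Complex.exp ((0 : ℝ) * Complex.I) := by
        push_cast
        rw [Complex.exp_two_pi_mul_I, zero_mul, Complex.exp_zero]
      have hzero : (0 : ℝ) ∈ Ico 0 (2 * Real.pi) := ⟨le_rfl, hpi⟩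
      rcases hend s hs with h1 | h1 <;> rcases hend t ht with h2 | h2
      · have : s = t := exp_mul_I_injOn h1 h2 e3
        exact ⟨j', by rw [this, hx, this], hj'⟩
      · rw [h2, h2pi] at e3
        have : s = 0 := exp_mul_I_injOn h1 hzero e3
        refine ⟨σ j', ?_, hj'.apply_right⟩
        rw [← hx, h2, ← hzσ, this, Function.comp_apply]
      · rw [h1, h2pi] at e3
        have : 0 = t := exp_mul_I_injOn hzero h2 e3
        refine ⟨σ.symm j', ?_, ?_⟩
        · rw [← hx, ← this, h1, ← hzσ, Function.comp_apply, Equiv.apply_symm_apply]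
        · rw [← Equiv.Perm.sameCycle_apply_right, Equiv.apply_symm_apply]
          exact hj'
      · exact ⟨j', by rw [h1, ← h2, hx, h2, h1], hj'⟩
    obtain ⟨k, hk, hjk⟩ := key
    exact hi'.trans ((hsame s hs k i' hk).symm.trans hjk.symm)
  have hcomp : ∀ i, ∀ x ∈ E i, connectedComponentIn L x = E i := by
    intro i x hx
    refine Subset.antisymm ?_ ((hEconn i).subset_connectedComponentIn hx (hEL i))
    -- The remaining cycles form a closed set that is disjoint from `E i` and together with it
    -- covers `L`; a connected set through `x` therefore stays in `E i`.
    have hF : IsClosed (⋃ j ∈ {j | ¬σ.SameCycle i j}, E j) :=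
      (Set.toFinite _).isClosed_biUnion fun j _ => hEclosed j
    have hpc := isPreconnected_connectedComponentIn (F := L) (x := x)
    rw [isPreconnected_iff_subset_of_disjoint_closed] at hpc
    have hno : ∀ y ∈ E i, y ∉ ⋃ j ∈ {j | ¬σ.SameCycle i j}, E j := by
      intro y hy hy'
      obtain ⟨j, hj, hyj⟩ := mem_iUnion₂.1 hy'
      exact hj (hdisj i j y hy hyj)
    refine (hpc _ _ (hEclosed i) hF ?_ ?_).resolve_right fun hsub => ?_
    · intro y hy
      obtain ⟨j, hj⟩ := hcov y (connectedComponentIn_subset _ _ hy)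
      by_cases hij : σ.SameCycle i j
      · left
        obtain ⟨s, hs, k, hk, rfl⟩ := hj
        exact ⟨s, hs, k, hij.trans hk, rfl⟩
      · exact Or.inr (mem_iUnion₂.2 ⟨j, hij, hj⟩)
    · rw [eq_empty_iff_forall_notMem]
      rintro y ⟨-, hy1, hy2⟩
      exact hno y hy1 hy2
    · exact hno x hx (hsub (mem_connectedComponentIn (hEL i hx)))
  refine ⟨(Set.finite_range E).subset ?_, fun x₀ hx₀ => ?_⟩
  · rintro Γ ⟨x, hx, rfl⟩
    obtain ⟨i, hi⟩ := hcov x hx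
    exact ⟨i, (hcomp i x hi).symm⟩
  obtain ⟨i, hi⟩ := hcov x₀ hx₀
  have hlevel : ∀ (k : ℕ), ∀ s ∈ Icc 0 (2 * Real.pi),
      u.eval (c i (s + k * (2 * Real.pi))) =
        Complex.exp (s * Complex.I) * v.eval (c i (s + k * (2 * Real.pi))) := by
    intro k s hs
    simp only [c, cyclePath_add hpi hzσ i k hs]
    exact hroot s _ (hzr s hs) _
  have hIco : ∀ t ∈ Icc 0 (m i * (2 * Real.pi)), t ∈ Ico 0 (m i * (2 * Real.pi)) ∨
      t = m i * (2 * Real.pi) := fun r hr => hr.2.lt_or_eq.imp (fun h => ⟨hr.1, h⟩) id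
  have hclosed := cyclePath_closed hpi hzσ i
  refine ⟨⟨0, m i * (2 * Real.pi), hm i, c i, hc i⟩, hclosed, (hE i).trans (hcomp i x₀ hi).symm,
    fun t ht => ?_, fun x hx hw => ?_⟩
  · change u.eval (c i t) = Complex.exp (t * Complex.I) * v.eval (c i t)
    rcases hIco t ht with h | h
    · obtain ⟨k, -, s, hs, rfl⟩ := exists_eq_add_mul hpi h
      rw [hlevel k s (Ico_subset_Icc_self hs), exp_add_natCast_mul]
    · have h1 := hlevel (m i) 0 (left_mem_Icc.2 hpi.le)
      have h2 := exp_add_natCast_mul 0 (m i)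
      rw [zero_add] at h1 h2
      rw [h, h1, h2]
  · change ∃! t, t ∈ Ico 0 (m i * (2 * Real.pi)) ∧ c i t = x
    have hx' : x ∈ c i '' Icc 0 (m i * (2 * Real.pi)) := by rw [hE, ← hcomp i x₀ hi]; exact hx
    obtain ⟨t, ht, htx⟩ := hx'
    obtain ⟨t, ht, htx⟩ : ∃ t ∈ Ico 0 (m i * (2 * Real.pi)), c i t = x := by
      rcases hIco t ht with h | h
      · exact ⟨t, h, htx⟩
      · exact ⟨0, ⟨le_rfl, hm i⟩, by rw [← htx, h]; exact hclosed⟩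
    refine ⟨t, ⟨ht, htx⟩, ?_⟩
    rintro t' ⟨ht', htx'⟩
    obtain ⟨k, hk, s, hs, rfl⟩ := exists_eq_add_mul hpi ht
    obtain ⟨k', hk', s', hs', rfl⟩ := exists_eq_add_mul hpi ht'
    have e1 := hlevel k s (Ico_subset_Icc_self hs)
    have e2 := hlevel k' s' (Ico_subset_Icc_self hs')
    have hxL : x ∈ L := connectedComponentIn_subset _ _ hx
    rw [htx] at e1
    rw [htx', e1] at e2
    have hss : s = s' := exp_mul_I_injOn hs hs' (mul_right_cancel₀ (hLv x hxL) e2)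
    subst hss
    simp only [c, cyclePath_add hpi hzσ i _ (Ico_subset_Icc_self hs)] at htx htx'
    have := (hzr s (Ico_subset_Icc_self hs)).eq_of_wronskian_ne_zero hlead
      (htx'.trans htx.symm) (by rw [htx']; exact hw)
    rw [Function.iterate_injOn_Iio_minimalPeriod hk' hk this]

/-! ### The total winding of the level curves -/

theorem Curve.exists_periodic_extension (γ : Curve) (h : γ.toFun γ.a = γ.toFun γ.b) :
    ∃ c : ℝ → ℂ, Continuous c ∧ (∀ t ∈ Icc γ.a γ.b, c t = γ.toFun t) ∧
      Function.Periodic c (γ.b - γ.a) := by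
  have : Fact (0 < γ.b - γ.a) := ⟨sub_pos.2 γ.a_lt_b⟩
  have hb : γ.a + (γ.b - γ.a) = γ.b := by ring
  let c : ℝ → ℂ := fun t => AddCircle.liftIco (γ.b - γ.a) γ.a γ.toFun (t : AddCircle (γ.b - γ.a))
  have hper : Function.Periodic c (γ.b - γ.a) := fun t => by simp [c]
  have hIco : ∀ t ∈ Ico γ.a γ.b, c t = γ.toFun t := fun t ht =>
    AddCircle.liftIco_coe_apply (by rwa [hb])
  refine ⟨c, ?_, fun t ht => ?_, hper⟩
  · exact (AddCircle.liftIco_continuous (by rwa [hb]) (by rw [hb]; exact γ.continuousOn)).comp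
      (AddCircle.continuous_mk' _)
  · rcases ht.2.lt_or_eq with h1 | h1
    · exact hIco t ⟨ht.1, h1⟩
    · rw [h1, ← h, ← hIco γ.a ⟨le_rfl, γ.a_lt_b⟩, ← hper γ.a, hb]

open Polynomial in
-- A vanishing Wronskian makes `v` divide `u v'`, hence `v'` by coprimality, which is possible only
-- for v' = 0.
theorem natDegree_eq_zero_of_wronskian_eq_zero {u v : ℂ[X]} (hcop : IsCoprime u v)
    (h : derivative u * v - u * derivative v = 0) : v.natDegree = 0 := by
  have h1 : v ∣ u * derivative v := ⟨derivative u, by rw [← sub_eq_zero.1 h]; ring⟩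
  have h2 : v ∣ derivative v := hcop.symm.dvd_of_dvd_mul_left h1
  by_contra h0
  have h3 : derivative v = 0 :=
    eq_zero_of_dvd_of_natDegree_lt h2 (natDegree_derivative_lt h0)
  exact h0 (derivative_eq_zero.1 h3)

theorem countable_setOf_exp_mul_I_eq (w : ℂ) :
    {t : ℝ | Complex.exp (t * Complex.I) = w}.Countable := by
  by_cases h : ∃ t₀ : ℝ, Complex.exp (t₀ * Complex.I) = w
  · obtain ⟨t₀, ht₀⟩ := h
    refine (Set.countable_range fun n : ℤ => t₀ + n * (2 * Real.pi)).mono fun t ht => ?_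
    obtain ⟨n, hn⟩ := Complex.exp_eq_exp_iff_exists_int.1
      ((show Complex.exp (t * Complex.I) = w from ht).trans ht₀.symm)
    refine ⟨n, ?_⟩
    have := congrArg Complex.im hn
    simp at this
    exact this.symm
  · convert Set.countable_empty
    rw [eq_empty_iff_forall_notMem]
    exact fun t ht => h ⟨t, ht⟩

theorem eval_right_ne_zero_of_isCoprime {u v : Polynomial ℂ} (hcop : IsCoprime u v) {x : ℂ}
    (hx : ‖u.eval x‖ = ‖v.eval x‖) : v.eval x ≠ 0 := by
  intro hv
  have hu : u.eval x = 0 := by rw [← norm_eq_zero, hx, hv, norm_zero]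
  obtain ⟨a, b, hab⟩ := hcop
  have := congrArg (Polynomial.eval x) hab
  simp [hu, hv] at this

theorem norm_eq_of_eq_exp_mul {p q : ℂ} {t : ℝ} (h : p = Complex.exp (t * Complex.I) * q) :
    ‖p‖ = ‖q‖ := by
  rw [h, norm_mul, Complex.norm_exp_ofReal_mul_I, one_mul]

/-- A nonzero Wronskian has finitely many roots, each of which spoils only countably many `t`. If
the Wronskian is zero, u and v are constants with |u| < |v|, and no level has any roots. -/
theorem dense_simple_level {u v : Polynomial ℂ} (hcop : IsCoprime u v)
    (hdeg : u.natDegree ≤ v.natDegree) (hlead : ‖u.coeff v.natDegree‖ < ‖v.leadingCoeff‖) :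
    Dense {t : ℝ | ∀ z, u.eval z = Complex.exp (t * Complex.I) * v.eval z →
      (u.derivative * v - u * v.derivative).eval z ≠ 0} := by
  by_cases hW : u.derivative * v - u * v.derivative = 0
  · have hv := natDegree_eq_zero_of_wronskian_eq_zero hcop hW
    have hu : u.natDegree = 0 := by omega
    convert dense_univ
    rw [eq_univ_iff_forall]
    intro t z hz
    have h1 := norm_eq_of_eq_exp_mul hz
    rw [Polynomial.eq_C_of_natDegree_eq_zero hu, Polynomial.eq_C_of_natDegree_eq_zero hv,
      Polynomial.eval_C, Polynomial.eval_C] at h1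
    rw [Polynomial.leadingCoeff, hv] at hlead
    exact absurd h1 hlead.ne
  · have hc : (⋃ z ∈ {z | (u.derivative * v - u * v.derivative).IsRoot z},
        {t : ℝ | Complex.exp (t * Complex.I) = u.eval z / v.eval z}).Countable :=
      (Polynomial.finite_setOfPred_isRoot hW).countable.biUnion fun z _ =>
        countable_setOf_exp_mul_I_eq _
    have hd := hc.dense_compl ℝ
    refine Dense.mono ?_ hd
    intro t ht z hz hw
    apply ht
    refine mem_iUnion₂.2 ⟨z, hw, ?_⟩
    have := eval_right_ne_zero_of_isCoprime hcop (norm_eq_of_eq_exp_mul hz)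
    change Complex.exp (t * Complex.I) = u.eval z / v.eval z
    rw [hz, mul_div_cancel_right₀ _ this]

/-- The argument change along closed curves of a product over all lifts. -/
theorem argChange_prod_periodic {ι : Type*} [Fintype ι] (m : ι → ℕ) (c : ι → ℝ → ℂ)
    (hc : ∀ i, Continuous (c i)) (h0 : ∀ i t, c i t ≠ 0)
    (hper : ∀ i, Function.Periodic (c i) (m i * (2 * Real.pi))) (a : ι → ℝ) :
    argChange (fun t => ∏ p : Σ i, Fin (m i), c p.1 (t + p.2 * (2 * Real.pi))) 0 (2 * Real.pi) =
      ∑ i, argChange (c i) (a i) (a i + m i * (2 * Real.pi)) := by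
  choose l hl hl' using fun i => exists_continuous_log (hc i) (h0 i)
  rw [argChange_eq_of_log Real.two_pi_pos.le
    (l := fun t => ∑ p : Σ i, Fin (m i), l p.1 (t + p.2 * (2 * Real.pi)))]
  · have hi : ∀ i, argChange (c i) (a i) (a i + m i * (2 * Real.pi)) =
        (l i (m i * (2 * Real.pi)) - l i 0).im / (2 * Real.pi) := by
      intro i
      rw [argChange_eq_of_log (le_add_of_nonneg_right (by positivity)) (hl i).continuousOn
        fun t _ => hl' i t]
      -- The increment of a logarithm over one period does not depend on the starting point, so `a
      -- i` may be replaced by 0.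
      have := sub_eq_sub_of_exp_eq (X := ℝ) isPreconnected_univ
        (l := fun t => l i (t + m i * (2 * Real.pi))) (m := l i)
        ((hl i).comp (by fun_prop)).continuousOn (hl i).continuousOn
        (fun t _ => by rw [hl', hl', hper i t]) (mem_univ (a i)) (mem_univ 0)
      simp only [zero_add] at this
      rw [this]
    simp only [hi, ← Finset.sum_div, ← Complex.im_sum]
    congr 2
    rw [← Finset.sum_sub_distrib, Fintype.sum_sigma]
    refine Finset.sum_congr rfl fun i _ => ?_
    -- The increments over the `m i` successive intervals of length 2π telescope to the increment
    -- over the full period.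
    have h1 := Fin.sum_univ_eq_sum_range (fun k : ℕ => l i (2 * Real.pi + k * (2 * Real.pi)) -
      l i (0 + k * (2 * Real.pi))) (m i)
    rw [h1]
    have h2 := Finset.sum_range_sub (fun k : ℕ => l i (k * (2 * Real.pi))) (m i)
    simp only [Nat.cast_zero, zero_mul] at h2
    rw [← h2]
    refine Finset.sum_congr rfl fun k _ => ?_
    rw [zero_add]
    congr 2
    push_cast
    ring
  · refine continuousOn_finsetSum _ fun p _ => ?_
    exact ((hl p.1).comp (by fun_prop)).continuousOn
  · intro t _
    rw [Complex.exp_sum]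
    exact Finset.prod_congr rfl fun p _ => hl' _ _

/-- The denominator u_d - e^{it} v_d turns once because |u_d| < |v_d|; the numerator turns once or
not at all, according to which of |u(x)|, |v(x)| is larger. -/
theorem argChange_levelPoly {u v : Polynomial ℂ}
    (hlead : ‖u.coeff v.natDegree‖ < ‖v.leadingCoeff‖) {x : ℂ} (hx : ‖u.eval x‖ ≠ ‖v.eval x‖)
    {ε : ℂ} (hε : ε ≠ 0) :
    argChange (fun t => ε * (levelPoly u v t).eval x) 0 (2 * Real.pi) =
      if ‖u.eval x‖ < ‖v.eval x‖ then 0 else -1 := by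
  have h := argChange_prod_zpow_mul_exp (Finset.univ : Finset (Fin 2)) ![1, -1]
    ![fun t : ℝ => u.eval x - Complex.exp (t * Complex.I) * v.eval x,
      fun t : ℝ => u.coeff v.natDegree - Complex.exp (t * Complex.I) * v.leadingCoeff]
    (F := fun t => ε * (levelPoly u v t).eval x) (a := 0) (b := 2 * Real.pi)
    Real.two_pi_pos.le (l := fun _ => Complex.log ε)
  rw [h]
  · simp only [Fin.sum_univ_two, Matrix.cons_val_zero, Matrix.cons_val_one,
      argChange_sub_exp_eq_one hlead]
    split_ifs with h1
    · rw [argChange_sub_exp_eq_one h1]; simp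
    · rw [argChange_sub_exp_eq_zero (lt_of_le_of_ne (not_lt.1 h1) hx.symm)]; simp
  · intro i _
    fin_cases i <;> simp <;> fun_prop
  · intro i _ t _
    fin_cases i
    · exact sub_exp_mul_ne_zero hx t
    · exact sub_exp_mul_ne_zero hlead.ne t
  · exact continuousOn_const
  · rfl
  · intro t _
    rw [Complex.exp_log hε, eval_levelPoly]
    simp
    ring

/-- The total winding about `x` of closed curves which travel once through the level set
`|u| = |v|`. -/
theorem sum_argChange_curve_sub {u v : Polynomial ℂ} (hcop : IsCoprime u v)
    (hinf : ∀ᶠ z in Bornology.cobounded ℂ, ‖u.eval z‖ < ‖v.eval z‖) {ι : Type*} [Fintype ι]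
    (γ : ι → Curve) (hclosed : ∀ i, (γ i).toFun (γ i).a = (γ i).toFun (γ i).b)
    (hlevel : ∀ i, ∀ t ∈ Icc (γ i).a (γ i).b,
      u.eval ((γ i).toFun t) = Complex.exp (t * Complex.I) * v.eval ((γ i).toFun t))
    (hsurj : ∀ z, ‖u.eval z‖ = ‖v.eval z‖ → (u.derivative * v - u * v.derivative).eval z ≠ 0 →
      ∃ i, ∃ t ∈ Ico (γ i).a (γ i).b, (γ i).toFun t = z)
    (hinj : ∀ i j, ∀ s ∈ Ico (γ i).a (γ i).b, ∀ t ∈ Ico (γ j).a (γ j).b,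
      (γ i).toFun s = (γ j).toFun t →
      (u.derivative * v - u * v.derivative).eval ((γ i).toFun s) ≠ 0 → i = j ∧ s = t)
    {x : ℂ} (hx : ‖u.eval x‖ ≠ ‖v.eval x‖) :
    ∑ i, argChange (fun t => (γ i).toFun t - x) (γ i).a (γ i).b =
      if ‖u.eval x‖ < ‖v.eval x‖ then 0 else -1 := by
  obtain ⟨hdeg, hlead⟩ := natDegree_le_and_norm_coeff_lt hinf
  have hpi := Real.two_pi_pos
  have hLv : ∀ {y : ℂ} {t : ℝ}, u.eval y = Complex.exp (t * Complex.I) * v.eval y →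
      v.eval y ≠ 0 := fun h =>
    eval_right_ne_zero_of_isCoprime hcop (norm_eq_of_eq_exp_mul h)
  -- A closed curve has the same value of u/v at both ends, so e^{ia} = e^{ib}.
  have hmex : ∀ i, ∃ m : ℕ, 0 < m ∧ (γ i).b - (γ i).a = m * (2 * Real.pi) := by
    intro i
    have h1 := hlevel i _ (left_mem_Icc.2 (γ i).a_lt_b.le)
    have h2 := hlevel i _ (right_mem_Icc.2 (γ i).a_lt_b.le)
    rw [← hclosed i, h1] at h2
    obtain ⟨n, hn⟩ := Complex.exp_eq_exp_iff_exists_int.1 (mul_right_cancel₀ (hLv h1) h2).symm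
    have h3 : (γ i).b = (γ i).a + n * (2 * Real.pi) := by
      have := congrArg Complex.im hn
      simpa using this
    have h4 : 0 < n := by
      have h5 : 0 < n * (2 * Real.pi) := by linarith [(γ i).a_lt_b]
      exact_mod_cast (pos_iff_pos_of_mul_pos h5).2 hpi
    refine ⟨n.toNat, by omega, ?_⟩
    have h6 : ((n.toNat : ℕ) : ℝ) = n := by exact_mod_cast Int.toNat_of_nonneg h4.le
    rw [h6]
    linarith
  choose m hm hmp using hmex
  choose c hc hcγ hcper using fun i => (γ i).exists_periodic_extension (hclosed i)
  have hrep : ∀ i t, ∃ s ∈ Ico (γ i).a (γ i).b, ∃ n : ℤ, t = s + n * (m i * (2 * Real.pi)) := by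
    intro i t
    have h1 : 0 < (γ i).b - (γ i).a := sub_pos.2 (γ i).a_lt_b
    refine ⟨toIcoMod h1 (γ i).a t, ?_, toIcoDiv h1 (γ i).a t, ?_⟩
    · have := toIcoMod_mem_Ico h1 (γ i).a t
      rwa [add_sub_cancel] at this
    · rw [← hmp, ← zsmul_eq_mul, toIcoMod_add_toIcoDiv_zsmul]
  simp only [hmp] at hcper
  have hcint : ∀ i t, ∀ n : ℤ, c i (t + n * (m i * (2 * Real.pi))) = c i t := fun i t n =>
    (hcper i).int_mul n t
  have hcγ' : ∀ i, ∀ s ∈ Ico (γ i).a (γ i).b, ∀ n : ℤ,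
      c i (s + n * (m i * (2 * Real.pi))) = (γ i).toFun s := fun i s hs n => by
    rw [hcint, hcγ i s (Ico_subset_Icc_self hs)]
  have hclevel : ∀ i t, u.eval (c i t) = Complex.exp (t * Complex.I) * v.eval (c i t) := by
    intro i t
    obtain ⟨s, hs, n, rfl⟩ := hrep i t
    rw [hcγ' i s hs, hlevel i s (Ico_subset_Icc_self hs)]
    congr 1
    rw [Complex.exp_eq_exp_iff_exists_int]
    refine ⟨-(n * m i), ?_⟩
    push_cast
    ring
  have hexp : ∀ (t : ℝ) (k : ℕ),
      Complex.exp (((t + k * (2 * Real.pi) : ℝ) : ℂ) * Complex.I) =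
        Complex.exp (t * Complex.I) := exp_add_natCast_mul
  -- At a level where the Wronskian is nonzero at all roots, the roots are simple and each is
  -- visited by exactly one curve at exactly one parameter of its period. So the lifts at `t` are in
  -- bijection with the roots of `levelPoly u v t`.
  have hgood : ∀ t : ℝ, (∀ z, u.eval z = Complex.exp (t * Complex.I) * v.eval z →
      (u.derivative * v - u * v.derivative).eval z ≠ 0) →
      ∏ p : Σ i, Fin (m i), (c p.1 (t + p.2 * (2 * Real.pi)) - x) =
        (-1) ^ v.natDegree * (levelPoly u v t).eval x := by
    intro t ht
    obtain ⟨z, hz⟩ := exists_isRootVector_of_monic (natDegree_levelPoly hdeg hlead t).2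
      (natDegree_levelPoly hdeg hlead t).1
    have hzlevel : ∀ j, u.eval (z j) = Complex.exp (t * Complex.I) * v.eval (z j) := fun j =>
      (eval_levelPoly_eq_zero_iff hlead t _).1 ((hz.exists_eq_iff _).1 ⟨j, rfl⟩)
    have hzinj : Function.Injective z := fun i j hij =>
      hz.eq_of_wronskian_ne_zero hlead hij (ht _ (hzlevel i))
    have hplevel : ∀ p : Σ i, Fin (m i), u.eval (c p.1 (t + p.2 * (2 * Real.pi))) =
        Complex.exp (t * Complex.I) * v.eval (c p.1 (t + p.2 * (2 * Real.pi))) := fun p => by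
      rw [hclevel, hexp]
    choose φ hφ using fun p : Σ i, Fin (m i) =>
      (hz.exists_eq_iff _).2 ((eval_levelPoly_eq_zero_iff hlead t _).2 (hplevel p))
    have hφinj : Function.Injective φ := by
      rintro ⟨i, k⟩ ⟨i', k'⟩ hpp
      have heq := (hφ ⟨i, k⟩).symm.trans ((congrArg z hpp).trans (hφ ⟨i', k'⟩))
      have hw := ht _ (hplevel ⟨i, k⟩)
      simp only at heq hw
      obtain ⟨s, hs, n, hn⟩ := hrep i (t + k * (2 * Real.pi))
      obtain ⟨s', hs', n', hn'⟩ := hrep i' (t + k' * (2 * Real.pi))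
      rw [hn, hcγ' i s hs] at hw
      rw [hn, hn', hcγ' i s hs, hcγ' i' s' hs'] at heq
      obtain ⟨rfl, rfl⟩ := hinj i i' s hs s' hs' heq hw
      have h1 : ((k : ℕ) : ℝ) - (k' : ℕ) = (n - n') * m i := by
        have h2 : (((k : ℕ) : ℝ) - (k' : ℕ) - (n - n') * m i) * (2 * Real.pi) = 0 := by
          linear_combination hn - hn'
        have := (mul_eq_zero.1 h2).resolve_right hpi.ne'
        linarith
      have h2 : (((k : ℕ) : ℤ) - (k' : ℕ)) = (n - n') * m i := by exact_mod_cast h1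
      have h3 : ((k : ℕ) : ℤ) - (k' : ℕ) = 0 := by
        refine Int.eq_zero_of_abs_lt_dvd (m := (m i : ℤ)) ⟨n - n', by rw [h2, mul_comm]⟩ ?_
        have := k.2
        have := k'.2
        rw [abs_lt]
        constructor <;> omega
      have : k = k' := Fin.ext (by omega)
      rw [this]
    have hφsurj : Function.Surjective φ := by
      intro j
      obtain ⟨i, s, hs, hsj⟩ := hsurj (z j) (norm_eq_of_eq_exp_mul (hzlevel j))
        (ht _ (hzlevel j))
      have h1 := hlevel i s (Ico_subset_Icc_self hs)
      rw [hsj, hzlevel j] at h1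
      obtain ⟨n, hn⟩ := Complex.exp_eq_exp_iff_exists_int.1
        (mul_right_cancel₀ (hLv (hzlevel j)) h1)
      have h2 : t = s + n * (2 * Real.pi) := by
        have := congrArg Complex.im hn
        simpa using this
      have hm0 : (0 : ℤ) < m i := by exact_mod_cast hm i
      have h3 := Int.emod_nonneg (-n) hm0.ne'
      have h4 := Int.emod_lt_of_pos (-n) hm0
      -- With t = s + 2πn, the shift by -n modulo `m i` leads back to `s` up to a multiple of the
      -- period of `c i`.
      refine ⟨⟨i, ⟨((-n) % m i).toNat, by omega⟩⟩, hzinj ?_⟩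
      rw [hφ]
      simp only
      have h5 : ((((-n) % m i).toNat : ℕ) : ℝ) = -n - m i * ((-n) / m i : ℤ) := by
        have h6 : ((((-n) % m i).toNat : ℕ) : ℤ) = -n - m i * ((-n) / m i) := by
          rw [Int.toNat_of_nonneg h3, Int.emod_def]
        exact_mod_cast h6
      have h7 : t + ((((-n) % m i).toNat : ℕ) : ℝ) * (2 * Real.pi) =
          s + (-((-n) / m i) : ℤ) * (m i * (2 * Real.pi)) := by
        rw [h5, h2]
        push_cast
        ring
      rw [h7, hcγ' i s hs, hsj]
    have hprod : ∏ p : Σ i, Fin (m i), (c p.1 (t + p.2 * (2 * Real.pi)) - x) =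
        ∏ j, (z j - x) := by
      rw [← Function.Bijective.prod_comp ⟨hφinj, hφsurj⟩ fun j => z j - x]
      exact Finset.prod_congr rfl fun p _ => by rw [hφ]
    have hzx : ∏ j, (x - z j) = (levelPoly u v t).eval x := hz x
    rw [hprod, ← hzx]
    have : ∀ j, z j - x = (-1) * (x - z j) := fun j => by ring
    rw [Finset.prod_congr rfl fun j _ => this j, Finset.prod_mul_distrib, Finset.prod_const,
      Finset.card_univ, Fintype.card_fin]
  have hall : (fun t : ℝ => ∏ p : Σ i, Fin (m i), (c p.1 (t + p.2 * (2 * Real.pi)) - x)) =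
      fun t => (-1) ^ v.natDegree * (levelPoly u v t).eval x := by
    refine Continuous.ext_on (dense_simple_level hcop hdeg hlead) ?_ ?_ hgood
    · refine continuous_finsetProd _ fun p _ => ?_
      exact ((hc p.1).comp (by fun_prop)).sub continuous_const
    · simp only [eval_levelPoly]
      exact continuous_const.mul
        (Continuous.div (by fun_prop) (by fun_prop) fun t => sub_exp_mul_ne_zero hlead.ne t)
  have hfinal := argChange_prod_periodic m (fun i t => c i t - x)
    (fun i => (hc i).sub continuous_const)
    (fun i t h => hx (by
      rw [← sub_eq_zero.1 h]; exact norm_eq_of_eq_exp_mul (hclevel i t)))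
    (fun i t => by simp only [hcper i t]) (fun i => (γ i).a)
  rw [hall, argChange_levelPoly hlead hx (pow_ne_zero _ (neg_ne_zero.2 one_ne_zero))] at hfinal
  rw [hfinal]
  refine Finset.sum_congr rfl fun i _ => ?_
  rw [← hmp, add_sub_cancel]
  obtain ⟨l, hl, hl'⟩ := exists_continuousOn_log_Icc (g := fun t => (γ i).toFun t - x)
    (γ i).a_lt_b.le ((γ i).continuousOn.sub continuousOn_const) (fun t ht h => hx (by
      rw [← sub_eq_zero.1 h]; exact norm_eq_of_eq_exp_mul (hlevel i t ht)))
  rw [argChange_eq_of_log (γ i).a_lt_b.le hl hl', argChange_eq_of_log (γ i).a_lt_b.le hl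
    fun t ht => by rw [hl' t ht, hcγ i t ht]]

/-! ### Indices at preimages and poles -/

section LocalIndex

/-- The conjugate of (z - a)^n is (z - a)^{-n} ‖z - a‖^{2n}, and the positive factor has the
continuous logarithm 2n log ‖z - a‖ off `a`. -/
theorem HasLocalIndex.of_conj {F : ℂ → ℂ} {a : ℂ} {n : ℤ}
    (h : HasLocalIndex (fun z => starRingEnd ℂ (F z)) a n) : HasLocalIndex F a (-n) := by
  obtain ⟨L, hL, hF⟩ := h.eventually
  refine hasLocalIndex_of_eventually
    (L := fun z => starRingEnd ℂ (L z) + (2 * n : ℂ) * Real.log ‖z - a‖) ?_ ?_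
  · filter_upwards [hL, self_mem_nhdsWithin] with z hz hza
    refine (Complex.continuous_conj.continuousAt.comp hz).add (continuousAt_const.mul ?_)
    refine Complex.continuous_ofReal.continuousAt.comp ?_
    exact ((continuousAt_id.sub continuousAt_const).norm).log
      (norm_ne_zero_iff.2 (sub_ne_zero.2 hza))
  · filter_upwards [hF, self_mem_nhdsWithin] with z hz hza
    have h0 : z - a ≠ 0 := sub_ne_zero.2 hza
    have h1 : F z = starRingEnd ℂ ((z - a) ^ n * Complex.exp (L z)) := by
      rw [← hz, Complex.conj_conj]
    have h2 : Complex.exp ((2 * n : ℂ) * Real.log ‖z - a‖) =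
        (z - a) ^ n * (starRingEnd ℂ (z - a)) ^ n := by
      rw [← mul_zpow, Complex.mul_conj, Complex.normSq_eq_norm_sq, mul_comm (2 : ℂ), mul_assoc,
        Complex.exp_int_mul]
      congr 1
      have h3 : (2 : ℂ) * Real.log ‖z - a‖ = ((Real.log (‖z - a‖ ^ 2) : ℝ) : ℂ) := by
        rw [Real.log_pow]; push_cast; ring
      rw [h3, ← Complex.ofReal_exp, Real.exp_log (by positivity)]
    rw [h1, Complex.exp_add, h2, map_mul, map_zpow₀, ← Complex.exp_conj, zpow_neg]
    have := zpow_ne_zero n h0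
    field_simp

/-- F/(z - a) differs from α by a term of modulus ‖β‖ and an error tending to 0, so near `a` it
stays in the disc about α through 0. -/
theorem hasLocalIndex_one_of_hasFDerivAt {F : ℂ → ℂ} {a α β : ℂ} {D : ℂ →L[ℝ] ℂ}
    (hF : ∀ᶠ z in 𝓝 a, ContinuousAt F z) (h0 : F a = 0) (hD : HasFDerivAt F D a)
    (hDα : ∀ h, D h = α * h + β * starRingEnd ℂ h) (hβ : ‖β‖ < ‖α‖) : HasLocalIndex F a 1 := by
  refine hasLocalIndex_of_norm_sub_lt (w := α) (G := fun z => F z / (z - a)) ?_ ?_ ?_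
  · filter_upwards [hF.filter_mono nhdsWithin_le_nhds, self_mem_nhdsWithin] with z h1 h2
    exact h1.div (continuousAt_id.sub continuousAt_const) (sub_ne_zero.2 h2)
  · have h1 := hD.isLittleO.def (sub_pos.2 hβ |> half_pos)
    filter_upwards [h1.filter_mono nhdsWithin_le_nhds, self_mem_nhdsWithin] with z h2 h3
    have hz : z - a ≠ 0 := sub_ne_zero.2 h3
    have hzn : 0 < ‖z - a‖ := norm_pos_iff.2 hz
    rw [h0, sub_zero, hDα] at h2
    have h4 : F z / (z - a) - α =
        (F z - (α * (z - a) + β * starRingEnd ℂ (z - a)) + β * starRingEnd ℂ (z - a)) /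
          (z - a) := by
      field_simp
      ring
    rw [h4, norm_div, div_lt_iff₀ hzn]
    refine (norm_add_le _ _).trans_lt ?_
    rw [norm_mul, Complex.norm_conj]
    nlinarith
  · filter_upwards [self_mem_nhdsWithin] with z h3
    have hz : z - a ≠ 0 := sub_ne_zero.2 h3
    rw [zpow_one]
    field_simp

theorem fderiv_apply_eq (f : ℂ → ℂ) (z h : ℂ) :
    fderiv ℝ f z h = dz f z * h + dzbar f z * starRingEnd ℂ h := by
  have h1 : h = h.re • (1 : ℂ) + h.im • Complex.I := by simp
  have h2 : fderiv ℝ f z h = h.re * fderiv ℝ f z 1 + h.im * fderiv ℝ f z Complex.I := by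
    conv_lhs => rw [h1]
    rw [map_add, map_smul, map_smul, Complex.real_smul, Complex.real_smul]
  have h3 : h = h.re + h.im * Complex.I := (Complex.re_add_im h).symm
  have h4 : starRingEnd ℂ h = h.re - h.im * Complex.I := by
    apply Complex.ext <;> simp
  rw [h2, h4, dz, dzbar]
  conv_rhs => rw [h3]
  simp only [Complex.add_re, Complex.ofReal_re, Complex.mul_re, Complex.I_re, mul_zero,
    Complex.ofReal_im, Complex.I_im, mul_one, sub_self, add_zero, Complex.add_im, Complex.mul_im,
    zero_add]
  linear_combination ((h.im : ℂ) * fderiv ℝ f z Complex.I) * Complex.I_sq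

/-- The index at a preimage is the sign of the Jacobian. -/
theorem hasLocalIndex_of_jacobian_ne_zero {f : ℂ → ℂ} {a η : ℂ}
    (hc : ∀ᶠ z in 𝓝 a, ContinuousAt f z) (hd : DifferentiableAt ℝ f a) (ha : f a = η)
    (hJ : jacobian f a ≠ 0) :
    HasLocalIndex (fun z => f z - η) a (if 0 < jacobian f a then 1 else -1) := by
  have hD : HasFDerivAt (fun z => f z - η) (fderiv ℝ f a) a := hd.hasFDerivAt.sub_const η
  have hc' : ∀ᶠ z in 𝓝 a, ContinuousAt (fun z => f z - η) z :=
    hc.mono fun z hz => hz.sub continuousAt_const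
  have hnn : ∀ x y : ℂ, 0 < ‖x‖ ^ 2 - ‖y‖ ^ 2 → ‖y‖ < ‖x‖ := fun x y h =>
    lt_of_pow_lt_pow_left₀ 2 (norm_nonneg _) (sub_pos.1 h)
  split_ifs with h
  · exact hasLocalIndex_one_of_hasFDerivAt hc' (by simp [ha]) hD (fderiv_apply_eq f a)
      (hnn _ _ h)
  · have h' : 0 < ‖dzbar f a‖ ^ 2 - ‖dz f a‖ ^ 2 := by
      have := lt_of_le_of_ne (not_lt.1 h) hJ
      rw [jacobian] at this
      linarith
    refine HasLocalIndex.of_conj ?_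
    refine hasLocalIndex_one_of_hasFDerivAt (α := starRingEnd ℂ (dzbar f a))
      (β := starRingEnd ℂ (dz f a))
      (D := (Complex.conjCLE : ℂ →L[ℝ] ℂ).comp (fderiv ℝ f a)) ?_ (by simp [ha])
      ((Complex.conjCLE : ℂ →L[ℝ] ℂ).hasFDerivAt.comp a hD) (fun h => ?_) ?_
    · exact hc'.mono fun z hz => Complex.continuous_conj.continuousAt.comp hz
    · simp only [ContinuousLinearMap.comp_apply, fderiv_apply_eq]
      simp
      ring
    · rw [Complex.norm_conj, Complex.norm_conj]
      exact hnn _ _ h'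

theorem tendsto_norm_log_mul_pow (p c η : ℂ) {n : ℕ} (hn : 1 ≤ n) :
    Tendsto (fun z => (c * Real.log ‖z - p‖ - η) * (z - p) ^ n) (𝓝[≠] p) (𝓝 0) := by
  have h1 : Tendsto (fun z : ℂ => ((‖z - p‖ * Real.log ‖z - p‖ : ℝ) : ℂ)) (𝓝 p) (𝓝 0) := by
    have h2 : Continuous fun z : ℂ => ((‖z - p‖ * Real.log ‖z - p‖ : ℝ) : ℂ) :=
      Complex.continuous_ofReal.comp (Real.continuous_mul_log.comp (by fun_prop))
    have := h2.tendsto p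
    simpa using this
  have h0 : Tendsto (fun z : ℂ => (Real.log ‖z - p‖ : ℂ) * (z - p)) (𝓝 p) (𝓝 0) := by
    refine squeeze_zero_norm (fun z => ?_) (tendsto_zero_iff_norm_tendsto_zero.1 h1)
    push_cast
    rw [norm_mul, norm_mul, mul_comm]
    simp
  obtain ⟨m, rfl⟩ := Nat.exists_eq_add_of_le' hn
  have h3 : Tendsto (fun z : ℂ => (z - p) ^ m) (𝓝 p) (𝓝 ((p - p) ^ m)) :=
    (by fun_prop : Continuous fun z : ℂ => (z - p) ^ m).tendsto p
  have h4 : Tendsto (fun z : ℂ => η * (z - p)) (𝓝 p) (𝓝 0) := by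
    have := (by fun_prop : Continuous fun z : ℂ => η * (z - p)).tendsto p
    simpa using this
  have h5 := (((h0.const_mul c).sub h4).mul h3).mono_left (nhdsWithin_le_nhds (s := {p}ᶜ))
  simp only [mul_zero, sub_zero, zero_mul] at h5
  refine h5.congr fun z => ?_
  ring

/-- After multiplication by (z - p)^n the conjugated term has modulus ‖B z‖, and the logarithm and η
become negligible as n ≥ 1. So the values stay in the disc about `A p` through 0. -/
theorem hasLocalIndex_of_pole_form {F A B : ℂ → ℂ} {p c η : ℂ} {n : ℕ} (hn : 1 ≤ n)
    (hA : ContinuousAt A p) (hB : ContinuousAt B p) (hAB : ‖B p‖ < ‖A p‖)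
    (hc : ∀ᶠ z in 𝓝[≠] p, ContinuousAt F z)
    (hF : ∀ᶠ z in 𝓝[≠] p, F z = A z / (z - p) ^ n + starRingEnd ℂ (B z / (z - p) ^ n)
      + c * (Real.log ‖z - p‖ : ℂ) - η) : HasLocalIndex F p (-n) := by
  refine hasLocalIndex_of_norm_sub_lt (w := A p) (G := fun z => F z * (z - p) ^ n) ?_ ?_ ?_
  · filter_upwards [hc] with z hz
    exact hz.mul (by fun_prop)
  · have h1 : Tendsto (fun z => ‖A z - A p‖ + ‖B z‖ +
        ‖(c * Real.log ‖z - p‖ - η) * (z - p) ^ n‖) (𝓝[≠] p) (𝓝 (‖A p - A p‖ + ‖B p‖ + ‖(0 : ℂ)‖)) :=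
      (((hA.sub continuousAt_const).norm.add hB.norm).tendsto.mono_left nhdsWithin_le_nhds).add
        (tendsto_norm_log_mul_pow p c η hn).norm
    rw [sub_self, norm_zero, zero_add, add_zero] at h1
    filter_upwards [h1.eventually (gt_mem_nhds hAB), hF, self_mem_nhdsWithin] with z h2 h3 h4
    refine lt_of_le_of_lt ?_ h2
    have hz : (z - p) ^ n ≠ 0 := pow_ne_zero _ (sub_ne_zero.2 h4)
    have h5 : F z * (z - p) ^ n - A p = (A z - A p) +
        starRingEnd ℂ (B z / (z - p) ^ n) * (z - p) ^ n +
        (c * Real.log ‖z - p‖ - η) * (z - p) ^ n := by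
      rw [h3]
      field_simp
      ring
    rw [h5]
    refine (norm_add_le _ _).trans (add_le_add_left ((norm_add_le _ _).trans ?_) _)
    rw [norm_mul, Complex.norm_conj, norm_div, div_mul_cancel₀ _ (norm_ne_zero_iff.2 hz)]
  · filter_upwards [self_mem_nhdsWithin] with z h3
    have hz : (z - p) ^ n ≠ 0 := pow_ne_zero _ (sub_ne_zero.2 h3)
    rw [zpow_neg, zpow_natCast]
    field_simp

/-- If `B` dominates, conjugation exchanges the roles of `A` and `B` and reverses the sign of the
index. -/
theorem hasLocalIndex_of_pole {f A B : ℂ → ℂ} {p c : ℂ} {n : ℕ} (hn : 1 ≤ n)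
    (hA : ContinuousAt A p) (hB : ContinuousAt B p) (hAB : ‖A p‖ ≠ ‖B p‖)
    (hc : ∀ᶠ z in 𝓝[≠] p, ContinuousAt f z)
    (hf : ∀ᶠ z in 𝓝[≠] p, f z = A z / (z - p) ^ n + starRingEnd ℂ (B z / (z - p) ^ n)
      + c * (Real.log ‖z - p‖ : ℂ)) (η : ℂ) :
    HasLocalIndex (fun z => f z - η) p (if ‖B p‖ < ‖A p‖ then -n else n) := by
  split_ifs with h
  · exact hasLocalIndex_of_pole_form hn hA hB h
      (hc.mono fun z hz => hz.sub continuousAt_const)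
      (hf.mono fun z hz => by rw [hz])
  · rw [← neg_neg (n : ℤ)]
    refine HasLocalIndex.of_conj ?_
    refine hasLocalIndex_of_pole_form (A := B) (B := A) (c := starRingEnd ℂ c)
      (η := starRingEnd ℂ η) hn hB hA (lt_of_le_of_ne (not_lt.1 h) hAB) ?_ ?_
    · exact hc.mono fun z hz =>
        Complex.continuous_conj.continuousAt.comp (hz.sub continuousAt_const)
    · filter_upwards [hf] with z hz
      rw [hz]
      simp only [map_sub, map_add, map_mul, Complex.conj_conj, Complex.conj_ofReal]
      ring

end LocalIndex

/-! ### Wirtinger derivatives of harmonic mappings -/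

section Wirtinger

/-- For a real harmonic h the function ∂ₓh - i∂ᵧh is holomorphic; both functions are complex linear
combinations of these for the real and imaginary parts of `f`. -/
theorem analyticAt_dz_and_dzbar {f : ℂ → ℂ} {z : ℂ} (hf : InnerProductSpace.HarmonicAt f z) :
    AnalyticAt ℂ (dz f) z ∧ AnalyticAt ℂ (fun w => starRingEnd ℂ (dzbar f w)) z := by
  have hre := HarmonicAt.analyticAt_complex_partial (hf.comp_CLM Complex.reCLM)
  have him := HarmonicAt.analyticAt_complex_partial (hf.comp_CLM Complex.imCLM)
  have hd : ∀ᶠ w in 𝓝 z, DifferentiableAt ℝ f w := by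
    filter_upwards [(hf.1.eventually (by simp))] with w hw
    exact hw.differentiableAt (by norm_num)
  have key : ∀ᶠ w in 𝓝 z, ∀ h, fderiv ℝ f w h =
      (fderiv ℝ (Complex.reCLM ∘ f) w h : ℂ) + Complex.I * (fderiv ℝ (Complex.imCLM ∘ f) w h : ℂ) := by
    filter_upwards [hd] with w hw h
    rw [(Complex.reCLM.hasFDerivAt.comp w hw.hasFDerivAt).fderiv,
      (Complex.imCLM.hasFDerivAt.comp w hw.hasFDerivAt).fderiv]
    simp only [ContinuousLinearMap.comp_apply, Complex.reCLM_apply, Complex.imCLM_apply]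
    rw [mul_comm, Complex.re_add_im]
  constructor
  · refine ((hre.add ((analyticAt_const (v := Complex.I)).mul him)).mul
      (analyticAt_const (v := (1 / 2 : ℂ)))).congr ?_
    filter_upwards [key] with w hw
    simp only [dz, hw, Pi.add_apply, Pi.mul_apply]
    ring
  · refine ((hre.sub ((analyticAt_const (v := Complex.I)).mul him)).mul
      (analyticAt_const (v := (1 / 2 : ℂ)))).congr ?_
    filter_upwards [key] with w hw
    have : starRingEnd ℂ (2 : ℂ) = 2 := Complex.conj_ofNat 2
    simp only [dzbar, hw, Pi.sub_apply, Pi.mul_apply, map_div₀, map_add, map_mul,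
      Complex.conj_I, Complex.conj_ofReal, this]
    ring

theorem dz_dzbar_of_eventuallyEq {f H G : ℂ → ℂ} {z H' G' : ℂ} (hH : HasDerivAt H H' z)
    (hG : HasDerivAt G G' z) (hf : f =ᶠ[𝓝 z] fun w => H w + starRingEnd ℂ (G w)) :
    dz f z = H' ∧ starRingEnd ℂ (dzbar f z) = G' := by
  have h1 : HasFDerivAt (fun w => H w + starRingEnd ℂ (G w))
      (H' • (1 : ℂ →L[ℝ] ℂ) + (Complex.conjCLE : ℂ →L[ℝ] ℂ).comp (G' • (1 : ℂ →L[ℝ] ℂ))) z :=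
    hH.complexToReal_fderiv.add
      ((Complex.conjCLE : ℂ →L[ℝ] ℂ).hasFDerivAt.comp z hG.complexToReal_fderiv)
  have h2 := hf.fderiv_eq (𝕜 := ℝ)
  rw [h1.fderiv] at h2
  constructor
  · rw [dz, h2]
    simp
    linear_combination (-(H' - starRingEnd ℂ G') / 2) * Complex.I_sq
  · rw [dzbar, h2]
    simp
    have : starRingEnd ℂ (2 : ℂ) = 2 := Complex.conj_ofNat 2
    rw [this]
    linear_combination (-(G' - starRingEnd ℂ H') / 2) * Complex.I_sq

/-- The Wirtinger derivatives near a pole. -/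
theorem pole_dz_dzbar {f A B : ℂ → ℂ} {p c : ℂ} {n : ℕ} (hn : 1 ≤ n) (hA : AnalyticAt ℂ A p)
    (hB : AnalyticAt ℂ B p)
    (hf : ∀ᶠ z in 𝓝[≠] p, f z = A z / (z - p) ^ n + starRingEnd ℂ (B z / (z - p) ^ n)
      + c * (Real.log ‖z - p‖ : ℂ)) :
    ∃ H G : ℂ → ℂ, AnalyticAt ℂ H p ∧ AnalyticAt ℂ G p ∧ H p = -n * A p ∧ G p = -n * B p ∧
      ∀ᶠ z in 𝓝[≠] p, (z - p) ^ (n + 1) * dz f z = H z ∧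
        (z - p) ^ (n + 1) * starRingEnd ℂ (dzbar f z) = G z := by
  have hn0 : n ≠ 0 := by omega
  have han : ∀ (A : ℂ → ℂ) (c : ℂ), AnalyticAt ℂ A p →
      AnalyticAt ℂ (fun z => (z - p) * deriv A z - n * A z + c / 2 * (z - p) ^ n) p := by
    intro A c hA
    have h1 : AnalyticAt ℂ (fun z : ℂ => z - p) p := analyticAt_id.sub analyticAt_const
    exact ((h1.mul hA.deriv).sub (analyticAt_const.mul hA)).add (analyticAt_const.mul (h1.pow n))
  refine ⟨fun z => (z - p) * deriv A z - n * A z + c / 2 * (z - p) ^ n,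
    fun z => (z - p) * deriv B z - n * B z + starRingEnd ℂ c / 2 * (z - p) ^ n,
    han A c hA, han B _ hB, by simp [hn0], by simp [hn0], ?_⟩
  have hev : ∀ᶠ z in 𝓝[≠] p, ∀ᶠ w in 𝓝 z,
      f w = A w / (w - p) ^ n + starRingEnd ℂ (B w / (w - p) ^ n) + c * (Real.log ‖w - p‖ : ℂ) := by
    have h1 := eventually_eventually_nhdsWithin.2 hf
    filter_upwards [h1, self_mem_nhdsWithin] with z hz hzp
    rwa [isOpen_compl_singleton.nhdsWithin_eq hzp] at hz
  filter_upwards [hev, self_mem_nhdsWithin,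
    hA.eventually_analyticAt.filter_mono nhdsWithin_le_nhds,
    hB.eventually_analyticAt.filter_mono nhdsWithin_le_nhds] with z hz hzp hAz hBz
  have h0 : z - p ≠ 0 := sub_ne_zero.2 hzp
  -- A branch of log(w - p) near `z` up to an imaginary constant, so its real part is log ‖w - p‖.
  -- It splits the logarithmic term into the holomorphic part (c/2)Λ and the conjugate of (c̄/2)Λ.
  let Λ : ℂ → ℂ := fun w => Complex.log ((w - p) / (z - p)) + Real.log ‖z - p‖
  have hΛ : HasDerivAt Λ (1 / (z - p)) z := by
    have h1 : HasDerivAt (fun w => (w - p) / (z - p)) (1 / (z - p)) z :=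
      ((hasDerivAt_id z).sub_const p).div_const _
    have h2 := h1.clog (by simp [div_self h0])
    simp only [div_self h0, div_one] at h2
    exact h2.add_const _
  have hlog : ∀ᶠ w in 𝓝 z, (Real.log ‖w - p‖ : ℂ) = (Λ w + starRingEnd ℂ (Λ w)) / 2 := by
    filter_upwards [isOpen_ne.mem_nhds hzp] with w hw
    rw [Complex.add_conj]
    have h1 : ‖w - p‖ ≠ 0 := norm_ne_zero_iff.2 (sub_ne_zero.2 hw)
    have h2 : ‖z - p‖ ≠ 0 := norm_ne_zero_iff.2 h0
    simp only [Λ, Complex.add_re, Complex.log_re, Complex.ofReal_re, norm_div]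
    rw [Real.log_div h1 h2]
    push_cast
    ring
  have hder : ∀ (A : ℂ → ℂ) (c : ℂ), AnalyticAt ℂ A z →
      HasDerivAt (fun w => A w / (w - p) ^ n + c / 2 * Λ w)
        ((deriv A z * (z - p) ^ n - A z * (n * (z - p) ^ (n - 1) * 1)) / ((z - p) ^ n) ^ 2 +
          c / 2 * (1 / (z - p))) z := by
    intro A c hA
    exact (hA.differentiableAt.hasDerivAt.div (((hasDerivAt_id z).sub_const p).pow n)
      (pow_ne_zero n h0)).add (hΛ.const_mul _)
  obtain ⟨e1, e2⟩ := dz_dzbar_of_eventuallyEq (f := f) (hder A c hAz) (hder B (starRingEnd ℂ c) hBz) (by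
    filter_upwards [hz, hlog] with w h1 h2
    rw [h1, h2]
    simp only [map_add, map_mul, map_div₀, Complex.conj_conj]
    have : starRingEnd ℂ (2 : ℂ) = 2 := Complex.conj_ofNat 2
    rw [this]
    ring)
  rw [e1, e2]
  obtain ⟨m, rfl⟩ := Nat.exists_eq_add_of_le' hn
  constructor <;>
  · simp only [Nat.add_sub_cancel]
    field_simp
    ring

end Wirtinger

/-! ### Rationality of the dilatation -/

/-- A bounded set without accumulation points is finite. -/
theorem finite_of_eventually_notMem {S : Set ℂ} (hb : Bornology.IsBounded S)
    (h : ∀ z, ∀ᶠ w in 𝓝[≠] z, w ∉ S) : S.Finite := by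
  by_contra hinf
  obtain ⟨x, -, hx⟩ := Set.Infinite.exists_accPt_of_subset_isCompact hinf
    hb.isCompact_closure subset_closure
  rw [accPt_iff_frequently_nhdsNE] at hx
  exact hx (h x)

/-- An entire function of polynomial growth is a polynomial. -/
theorem exists_polynomial_of_growth (N : ℕ) : ∀ (ψ : ℂ → ℂ) (C : ℝ), Differentiable ℂ ψ →
    (∀ᶠ z in Bornology.cobounded ℂ, ‖ψ z‖ ≤ C * ‖z‖ ^ N) →
    ∃ q : Polynomial ℂ, ∀ z, ψ z = q.eval z := by
  induction N with
  | zero =>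
    intro ψ C hψ hC
    simp only [pow_zero, mul_one] at hC
    have hb : Bornology.IsBounded (range ψ) := by
      have h1 : Bornology.IsBounded {z | ¬‖ψ z‖ ≤ C} := by
        rw [Bornology.isBounded_def]
        filter_upwards [hC] with z hz h using h hz
      have h2 := h1.isCompact_closure.image hψ.continuous
      refine (h2.isBounded.union (Metric.isBounded_closedBall (x := (0 : ℂ)) (r := C))).subset ?_
      rintro _ ⟨z, rfl⟩
      by_cases h : ‖ψ z‖ ≤ C
      · exact Or.inr (by simpa using h)
      · exact Or.inl ⟨z, subset_closure h, rfl⟩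
    obtain ⟨c, hc⟩ := hψ.exists_const_forall_eq_of_bounded hb
    exact ⟨Polynomial.C c, fun z => by simp [hc]⟩
  | succ N ih =>
    intro ψ C hψ hC
    -- (ψ(z) - ψ(0))/z is entire and grows by one power less.
    have hd : Differentiable ℂ (dslope ψ 0) := by
      rw [← differentiableOn_univ, Complex.differentiableOn_dslope univ_mem]
      exact hψ.differentiableOn
    obtain ⟨q, hq⟩ := ih (dslope ψ 0) (C + ‖ψ 0‖) hd (by
      filter_upwards [hC, tendsto_norm_cobounded_atTop.eventually (eventually_ge_atTop 1)]
        with z h1 h2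
      have hz : z ≠ 0 := norm_pos_iff.1 (by linarith)
      rw [dslope_of_ne _ hz, slope_def_field, sub_zero, norm_div,
        div_le_iff₀ (norm_pos_iff.2 hz)]
      refine (norm_sub_le _ _).trans ?_
      have h3 : 1 ≤ ‖z‖ ^ N * ‖z‖ := by
        rw [← pow_succ]; exact one_le_pow₀ h2
      have h4 := mul_le_mul_of_nonneg_left h3 (norm_nonneg (ψ 0))
      rw [pow_succ] at h1
      linarith)
    refine ⟨Polynomial.C (ψ 0) + Polynomial.X * q, fun z => ?_⟩
    have h1 := sub_smul_dslope ψ 0 z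
    rw [sub_zero, smul_eq_mul, hq z] at h1
    simp [h1]

theorem exists_norm_eval_le (q : Polynomial ℂ) :
    ∃ (C : ℝ) (N : ℕ), ∀ᶠ z in Bornology.cobounded ℂ, ‖q.eval z‖ ≤ C * ‖z‖ ^ N := by
  refine ⟨∑ i ∈ Finset.range (q.natDegree + 1), ‖q.coeff i‖, q.natDegree, ?_⟩
  filter_upwards [tendsto_norm_cobounded_atTop.eventually (eventually_ge_atTop 1)] with z hz
  rw [Polynomial.eval_eq_sum_range, Finset.sum_mul]
  refine (norm_sum_le _ _).trans (Finset.sum_le_sum fun i hi => ?_)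
  rw [norm_mul, norm_pow]
  exact mul_le_mul_of_nonneg_left
    (pow_le_pow_right₀ hz (Nat.lt_succ_iff.1 (Finset.mem_range.1 hi))) (norm_nonneg _)

/-- A meromorphic function on the plane which is bounded and analytic near infinity is rational. -/
theorem exists_polynomial_mul_eq {φ : ℂ → ℂ} (hφ : ∀ z, MeromorphicAt φ z)
    (hinf : ∀ᶠ z in Bornology.cobounded ℂ, AnalyticAt ℂ φ z ∧ ‖φ z‖ ≤ 1) :
    ∃ u v : Polynomial ℂ, v ≠ 0 ∧ ∀ z, φ z * v.eval z = u.eval z := by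
  classical
  have hfin : {z | ¬AnalyticAt ℂ φ z}.Finite := by
    refine finite_of_eventually_notMem ?_ fun z => ?_
    · rw [Bornology.isBounded_def]
      filter_upwards [hinf] with z hz h using h hz.1
    · filter_upwards [(hφ z).eventually_analyticAt] with w hw h using h hw
  choose n hn using hφ
  -- The exponents come from meromorphy, so that multiplication by `v` makes φ entire.
  let v : Polynomial ℂ := ∏ a ∈ hfin.toFinset, (Polynomial.X - Polynomial.C a) ^ n a
  have hv0 : v ≠ 0 := Finset.prod_ne_zero_iff.2 fun a _ =>
    pow_ne_zero _ (Polynomial.X_sub_C_ne_zero a)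
  have hanal : ∀ z, AnalyticAt ℂ (fun w => φ w * v.eval w) z := by
    intro z
    by_cases hz : AnalyticAt ℂ φ z
    · exact hz.mul (v.differentiable.analyticAt z)
    · have hmem : z ∈ hfin.toFinset := by simpa using hz
      let v' : Polynomial ℂ :=
        ∏ a ∈ hfin.toFinset.erase z, (Polynomial.X - Polynomial.C a) ^ n a
      have h1 := (hn z).mul (v'.differentiable.analyticAt z)
      refine h1.congr (Eventually.of_forall fun w => ?_)
      have h2 : v = (Polynomial.X - Polynomial.C z) ^ n z * v' :=
        (Finset.mul_prod_erase _ _ hmem).symm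
      simp only [Pi.mul_apply, h2, Polynomial.eval_mul, Polynomial.eval_pow, Polynomial.eval_sub,
        Polynomial.eval_X, Polynomial.eval_C, smul_eq_mul]
      ring
  obtain ⟨C, N, hCN⟩ := exists_norm_eval_le v
  obtain ⟨u, hu⟩ := exists_polynomial_of_growth N (fun w => φ w * v.eval w) C
    (fun z => (hanal z).differentiableAt) (by
      filter_upwards [hinf, hCN] with z h1 h2
      rw [norm_mul]
      exact (mul_le_of_le_one_left (norm_nonneg _) h1.2).trans h2)
  exact ⟨u, v, hv0, hu⟩

theorem eval_eventually_ne_zero {g : Polynomial ℂ} (hg : g ≠ 0) (z : ℂ) :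
    ∀ᶠ w in 𝓝[≠] z, g.eval w ≠ 0 := by
  have h1 : {w | g.eval w = 0}.Finite := Polynomial.finite_setOfPred_isRoot hg
  have h2 : IsClosed ({w | g.eval w = 0} \ {z}) := (h1.subset sdiff_subset).isClosed
  have h3 : ({w | g.eval w = 0} \ {z})ᶜ ∈ 𝓝 z := h2.isOpen_compl.mem_nhds (by simp)
  filter_upwards [mem_nhdsWithin_of_mem_nhds h3, self_mem_nhdsWithin] with w hw hwz h0
  exact hw ⟨h0, hwz⟩

theorem exists_isCoprime_mul_eq {φ : ℂ → ℂ} {u v : Polynomial ℂ} (hv : v ≠ 0)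
    (h : ∀ z, φ z * v.eval z = u.eval z) :
    ∃ u' v' : Polynomial ℂ, IsCoprime u' v' ∧ v' ≠ 0 ∧
      ∀ z, ∀ᶠ w in 𝓝[≠] z, φ w * v'.eval w = u'.eval w := by
  classical
  obtain ⟨g, hgdef⟩ : ∃ g, g = EuclideanDomain.gcd u v := ⟨_, rfl⟩
  obtain ⟨u', hu'⟩ := EuclideanDomain.gcd_dvd_left u v
  obtain ⟨v', hv'⟩ := EuclideanDomain.gcd_dvd_right u v
  have hab := EuclideanDomain.gcd_eq_gcd_ab u v
  have hg : g ≠ 0 := fun h0 => hv (EuclideanDomain.gcd_eq_zero_iff.1 (hgdef ▸ h0)).2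
  rw [← hgdef] at hu' hv' hab
  refine ⟨u', v', ⟨EuclideanDomain.gcdA u v, EuclideanDomain.gcdB u v, ?_⟩, ?_, fun z => ?_⟩
  · apply mul_left_cancel₀ hg
    linear_combination (-EuclideanDomain.gcdA u v) * hu' -
      EuclideanDomain.gcdB u v * hv' - hab
  · rintro rfl
    exact hv (by rw [hv', mul_zero])
  · filter_upwards [eval_eventually_ne_zero hg z] with w hw
    have h1 := h w
    rw [hu', hv', Polynomial.eval_mul, Polynomial.eval_mul] at h1
    apply mul_left_cancel₀ hw
    linear_combination h1

theorem eval_ne_zero_of_isCoprime {u v : Polynomial ℂ} (hcop : IsCoprime u v) (x : ℂ) :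
    u.eval x ≠ 0 ∨ v.eval x ≠ 0 := by
  by_contra! h
  obtain ⟨a, b, hab⟩ := hcop
  have := congrArg (Polynomial.eval x) hab
  simp [h.1, h.2] at this

/-- Coprimality excludes a common zero of u and v. The cross-multiplied form, with u and v
exchanged, also covers the poles of ω. -/
theorem norm_eval_lt_of_mul_eq {u v : Polynomial ℂ} (hcop : IsCoprime u v) {x h g : ℂ}
    (heq : u.eval x * h = v.eval x * g) (hlt : ‖g‖ < ‖h‖) : ‖u.eval x‖ < ‖v.eval x‖ := by
  have hh : 0 < ‖h‖ := (norm_nonneg _).trans_lt hlt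
  have h1 : ‖u.eval x‖ * ‖h‖ = ‖v.eval x‖ * ‖g‖ := by rw [← norm_mul, heq, norm_mul]
  have hv : 0 < ‖v.eval x‖ := by
    rw [norm_pos_iff]
    intro hv
    rw [hv, norm_zero, zero_mul] at h1
    have : u.eval x = 0 := norm_eq_zero.1 ((mul_eq_zero.1 h1).resolve_right hh.ne')
    exact (eval_ne_zero_of_isCoprime hcop x).elim (fun h => h this) (fun h => h hv)
  by_contra hcon
  nlinarith [mul_lt_mul_of_pos_left hlt hv, mul_le_mul_of_nonneg_right (not_lt.1 hcon) hh.le]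

/-- The dilatation of a non-degenerate harmonic mapping is rational. -/
theorem IsNondegenerate.exists_rational_dilatation {f : ℂ → ℂ} {P : Finset ℂ}
    (hf : IsNondegenerate f P) : ∃ u v : Polynomial ℂ, IsCoprime u v ∧
      (∀ᶠ z in Bornology.cobounded ℂ, ‖u.eval z‖ < ‖v.eval z‖) ∧
      (∀ z ∉ P, dilatation f P z = u.eval z / v.eval z) ∧
      ∀ z ∉ P, u.eval z * dz f z = v.eval z * starRingEnd ℂ (dzbar f z) := by
  have han : ∀ z ∉ P, AnalyticAt ℂ (dz f) z ∧
      AnalyticAt ℂ (fun w => starRingEnd ℂ (dzbar f w)) z := fun z hz =>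
    analyticAt_dz_and_dzbar (hf.harmonic z (by simpa using hz))
  have hPinf : ∀ᶠ z in Bornology.cobounded ℂ, z ∉ P := by
    have : Bornology.IsBounded (P : Set ℂ) := P.finite_toSet.isBounded
    rw [Bornology.isBounded_def] at this
    exact this
  have hJ : ∀ᶠ z in Bornology.cobounded ℂ, ‖dzbar f z‖ < ‖dz f z‖ := by
    filter_upwards [hf.sense_preserving_at_infty] with z hz
    exact lt_of_pow_lt_pow_left₀ 2 (norm_nonneg _) (sub_pos.1 hz)
  have hmer : ∀ z, MeromorphicAt (dz f) z ∧
      MeromorphicAt (fun w => starRingEnd ℂ (dzbar f w)) z := by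
    intro z
    by_cases hz : z ∈ P
    · obtain ⟨n, A, B, c, hn, hA, hB, -, hform⟩ := hf.pole_form z hz
      obtain ⟨H, G, hH, hG, -, -, hHG⟩ := pole_dz_dzbar hn hA hB hform
      have hpow : MeromorphicAt (fun w : ℂ => (w - z) ^ (n + 1)) z :=
        ((analyticAt_id.sub analyticAt_const).pow (n + 1)).meromorphicAt
      constructor
      · refine (hH.meromorphicAt.div hpow).congr ?_
        filter_upwards [hHG, self_mem_nhdsWithin] with w hw hwz
        have := pow_ne_zero (n + 1) (sub_ne_zero.2 hwz)
        rw [Pi.div_apply, ← hw.1, mul_div_cancel_left₀ _ this]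
      · refine (hG.meromorphicAt.div hpow).congr ?_
        filter_upwards [hHG, self_mem_nhdsWithin] with w hw hwz
        have := pow_ne_zero (n + 1) (sub_ne_zero.2 hwz)
        rw [Pi.div_apply, ← hw.2, mul_div_cancel_left₀ _ this]
    · exact ⟨(han z hz).1.meromorphicAt, (han z hz).2.meromorphicAt⟩
  set φ : ℂ → ℂ := fun z => starRingEnd ℂ (dzbar f z) / dz f z with hφ
  have hφmer : ∀ z, MeromorphicAt φ z := fun z => (hmer z).2.div (hmer z).1
  obtain ⟨u₀, v₀, hv₀, huv₀⟩ := exists_polynomial_mul_eq hφmer (by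
    filter_upwards [hPinf, hJ] with z h1 h2
    have h3 : 0 < ‖dz f z‖ := (norm_nonneg _).trans_lt h2
    refine ⟨(han z h1).2.div (han z h1).1 (norm_pos_iff.1 h3), ?_⟩
    rw [hφ, norm_div, Complex.norm_conj, div_le_one h3]
    exact h2.le)
  obtain ⟨u, v, hcop, hv, huv⟩ := exists_isCoprime_mul_eq hv₀ huv₀
  -- Otherwise the identity theorem on the connected set ℂ \ P makes ∂f/∂z vanish identically,
  -- against the positive Jacobian near infinity.
  have hne : ∀ z ∉ P, ∀ᶠ w in 𝓝[≠] z, dz f w ≠ 0 := by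
    intro z hz
    refine (han z hz).1.eventually_eq_zero_or_eventually_ne_zero.resolve_left fun h0 => ?_
    have hconn : IsPreconnected ((P : Set ℂ)ᶜ) :=
      (P.finite_toSet.countable.isPathConnected_compl_of_one_lt_rank
        (by rw [Complex.rank_real_complex]; norm_num)).isConnected.isPreconnected
    have hzero := AnalyticOnNhd.eqOn_zero_of_preconnected_of_eventuallyEq_zero
      (fun w hw => (han w (by simpa using hw)).1) hconn (show z ∈ (P : Set ℂ)ᶜ by simpa using hz) h0
    obtain ⟨w, h1, h2⟩ := (hPinf.and hJ).exists
    have : dz f w = 0 := hzero (by simpa using h1)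
    rw [this, norm_zero] at h2
    exact absurd h2 (not_lt.2 (norm_nonneg _))
  have hmul : ∀ z ∉ P, u.eval z * dz f z = v.eval z * starRingEnd ℂ (dzbar f z) := by
    intro z hz
    have h1 : Tendsto (fun w => u.eval w * dz f w) (𝓝[≠] z) (𝓝 (u.eval z * dz f z)) :=
      (u.continuous.continuousAt.mul (han z hz).1.continuousAt).tendsto.mono_left
        nhdsWithin_le_nhds
    have h2 : Tendsto (fun w => v.eval w * starRingEnd ℂ (dzbar f w)) (𝓝[≠] z)
        (𝓝 (v.eval z * starRingEnd ℂ (dzbar f z))) :=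
      (v.continuous.continuousAt.mul (han z hz).2.continuousAt).tendsto.mono_left
        nhdsWithin_le_nhds
    refine tendsto_nhds_unique h1 (h2.congr' ?_)
    filter_upwards [huv z, hne z hz] with w h3 h4
    rw [← h3, hφ]
    field_simp
  refine ⟨u, v, hcop, ?_, fun z hz => ?_, hmul⟩
  · filter_upwards [hPinf, hJ] with z h1 h2
    exact norm_eval_lt_of_mul_eq hcop (hmul z h1) (by rwa [Complex.norm_conj])
  · have hNF : MeromorphicNFAt (fun w => u.eval w / v.eval w) z :=
      MeromorphicNFOn.div (u.differentiable.analyticAt z)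
        (v.differentiable.analyticAt z).meromorphicNFAt (eval_ne_zero_of_isCoprime hcop z).symm
    have hev : φ =ᶠ[𝓝[≠] z] fun w => u.eval w / v.eval w := by
      filter_upwards [huv z, eval_eventually_ne_zero hv z] with w h1 h2
      rw [← h1, mul_div_cancel_right₀ _ h2]
    rw [dilatation, toMeromorphicNFOn_eq_toMeromorphicNFAt (fun w _ => hφmer w)
      (by simpa using hz), (toMeromorphicNFAt_eventuallyEq_nhds_congr hev).self_of_nhds,
      toMeromorphicNFAt_eq_self.2 hNF]

/-! ### The critical set and the preimages of f -/

variable {f : ℂ → ℂ} {P : Finset ℂ} {u v : Polynomial ℂ}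

theorem IsNondegenerate.continuousAt (hf : IsNondegenerate f P) {z : ℂ} (hz : z ∉ P) :
    ContinuousAt f z :=
  (hf.harmonic z (by simpa using hz)).1.continuousAt

theorem IsNondegenerate.differentiableAt (hf : IsNondegenerate f P) {z : ℂ} (hz : z ∉ P) :
    DifferentiableAt ℝ f z :=
  (hf.harmonic z (by simpa using hz)).1.differentiableAt (by norm_num)

theorem eventually_notMem_nhds {z : ℂ} (hz : z ∉ P) : ∀ᶠ w in 𝓝 z, w ∉ P :=
  P.finite_toSet.isClosed.isOpen_compl.mem_nhds (show z ∈ (P : Set ℂ)ᶜ by simpa using hz)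

theorem eventually_notMem_nhdsNE (P : Finset ℂ) (z : ℂ) : ∀ᶠ w in 𝓝[≠] z, w ∉ P := by
  classical
  have h := eventually_notMem_nhds (P := P.erase z) (z := z) (by simp)
  filter_upwards [h.filter_mono nhdsWithin_le_nhds, self_mem_nhdsWithin] with w h1 h2 h3
  exact h1 (Finset.mem_erase.2 ⟨h2, h3⟩)

/-- At a pole, the index of `f - η` does not depend on `η`, and its sign is determined by the
dilatation. -/
theorem IsNondegenerate.exists_index_pole (hf : IsNondegenerate f P) (hcop : IsCoprime u v)
    (hmul : ∀ z ∉ P, u.eval z * dz f z = v.eval z * starRingEnd ℂ (dzbar f z)) {p : ℂ}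
    (hp : p ∈ P) : ∃ k : ℤ, (∀ η, HasLocalIndex (fun z => f z - η) p k) ∧
      (‖u.eval p‖ < ‖v.eval p‖ ∧ k ≤ 0 ∨ ‖v.eval p‖ < ‖u.eval p‖ ∧ 0 ≤ k) := by
  obtain ⟨n, A, B, c, hn, hA, hB, hAB, hform⟩ := hf.pole_form p hp
  obtain ⟨H, G, hH, hG, hHp, hGp, hHG⟩ := pole_dz_dzbar hn hA hB hform
  have hPev := eventually_notMem_nhdsNE P p
  have hlim : u.eval p * H p = v.eval p * G p := by
    have h1 : Tendsto (fun w => u.eval w * H w) (𝓝[≠] p) (𝓝 (u.eval p * H p)) :=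
      (u.continuous.continuousAt.mul hH.continuousAt).tendsto.mono_left nhdsWithin_le_nhds
    have h2 : Tendsto (fun w => v.eval w * G w) (𝓝[≠] p) (𝓝 (v.eval p * G p)) :=
      (v.continuous.continuousAt.mul hG.continuousAt).tendsto.mono_left nhdsWithin_le_nhds
    refine tendsto_nhds_unique h1 (h2.congr' ?_)
    filter_upwards [hHG, hPev] with w h3 h4
    rw [← h3.1, ← h3.2]
    linear_combination (-(w - p) ^ (n + 1)) * hmul w h4
  have hn0 : (n : ℂ) ≠ 0 := by exact_mod_cast (by omega : n ≠ 0)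
  -- In cross-multiplied form, ω(p) = b_{-n} / a_{-n}. So the comparison of |ω(p)| with 1 decides
  -- the sign of the index.
  have heq : u.eval p * A p = v.eval p * B p := by
    rw [hHp, hGp] at hlim
    apply mul_left_cancel₀ hn0
    linear_combination -hlim
  refine ⟨if ‖B p‖ < ‖A p‖ then -n else n, fun η =>
    hasLocalIndex_of_pole hn hA.continuousAt hB.continuousAt hAB
      (hPev.mono fun z hz => hf.continuousAt hz) hform η, ?_⟩
  split_ifs with h
  · exact Or.inl ⟨norm_eval_lt_of_mul_eq hcop heq h, by omega⟩
  · exact Or.inr ⟨norm_eval_lt_of_mul_eq hcop.symm heq.symm (lt_of_le_of_ne (not_lt.1 h) hAB),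
      by omega⟩

/-- Where both Wirtinger derivatives vanish, the Jacobian says nothing about ω; such a critical
point belongs to the level set exactly when the continued quotient u/v has modulus 1. -/
theorem criticalSet_sdiff_exceptionalSet (hcop : IsCoprime u v)
    (hdil : ∀ z ∉ P, dilatation f P z = u.eval z / v.eval z)
    (hmul : ∀ z ∉ P, u.eval z * dz f z = v.eval z * starRingEnd ℂ (dzbar f z))
    (hP : ∀ p ∈ P, ‖u.eval p‖ ≠ ‖v.eval p‖) :
    criticalSet f P \ exceptionalSet f P = {z | ‖u.eval z‖ = ‖v.eval z‖} := by
  ext z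
  constructor
  · rintro ⟨hz, hz'⟩
    have h1 : ‖dilatation f P z‖ = 1 := by
      by_contra h
      exact hz' ⟨hz, h⟩
    rw [hdil z hz.1, norm_div] at h1
    have hv : ‖v.eval z‖ ≠ 0 := fun h => by simp [h] at h1
    exact (div_eq_one_iff_eq hv).1 h1
  · intro hz
    have hz' : ‖u.eval z‖ = ‖v.eval z‖ := hz
    have hzP : z ∉ P := fun h => hP z h hz
    have hv : ‖v.eval z‖ ≠ 0 :=
      norm_ne_zero_iff.2 (eval_right_ne_zero_of_isCoprime hcop hz)
    refine ⟨⟨hzP, ?_⟩, fun h => h.2 ?_⟩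
    · have h1 := congrArg norm (hmul z hzP)
      rw [norm_mul, norm_mul, Complex.norm_conj, hz'] at h1
      rw [jacobian, mul_left_cancel₀ hv h1, sub_self]
    · rw [hdil z hzP, norm_div, hz', div_self hv]

theorem deriv_dilatation_ne_zero_iff (hdil : ∀ z ∉ P, dilatation f P z = u.eval z / v.eval z)
    {z : ℂ} (hz : z ∉ P) (hv : v.eval z ≠ 0) : deriv (dilatation f P) z ≠ 0 ↔
      (u.derivative * v - u * v.derivative).eval z ≠ 0 := by
  have h1 : dilatation f P =ᶠ[𝓝 z] fun w => u.eval w / v.eval w :=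
    (eventually_notMem_nhds hz).mono hdil
  have h2 : HasDerivAt (fun w => u.eval w / v.eval w) _ z :=
    (u.hasDerivAt z).div (v.hasDerivAt z) hv
  rw [h1.deriv_eq, h2.deriv, Polynomial.eval_sub,
    Polynomial.eval_mul, Polynomial.eval_mul, ne_eq, div_eq_zero_iff,
    or_iff_left (pow_ne_zero 2 hv)]

/-- Preimages are bounded and cannot accumulate: f tends to infinity at the poles, and a preimage is
non-critical, so it is an isolated zero of f - η. -/
theorem IsNondegenerate.finite_preimages (hf : IsNondegenerate f P) {η : ℂ}
    (hη : η ∉ f '' criticalSet f P) (hinf : ∀ᶠ z in Bornology.cobounded ℂ, f z - η ≠ 0) :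
    (preimages f P η).Finite := by
  refine finite_of_eventually_notMem ?_ fun z => ?_
  · rw [Bornology.isBounded_def]
    filter_upwards [hinf] with z hz h using hz (sub_eq_zero.2 h.2)
  · by_cases hz : z ∈ P
    · have h1 : ∀ᶠ w in 𝓝[≠] z, f w ≠ η := (hf.pole z hz).eventually
        (Bornology.isBounded_def.1 (Bornology.isBounded_singleton (x := η)))
      exact h1.mono fun w hw h => hw h.2
    · by_cases hzη : f z = η
      · have hJ : jacobian f z ≠ 0 := fun h => hη ⟨z, ⟨hz, h⟩, hzη⟩
        have h1 := (hasLocalIndex_of_jacobian_ne_zero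
          ((eventually_notMem_nhds hz).mono fun w hw => hf.continuousAt hw)
          (hf.differentiableAt hz) hzη hJ).eventually_ne_zero
        exact h1.mono fun w hw h => hw (sub_eq_zero.2 h.2)
      · have h1 : ∀ᶠ w in 𝓝 z, f w ≠ η := (hf.continuousAt hz).eventually_ne hzη
        exact (h1.filter_mono nhdsWithin_le_nhds).mono fun w hw h => hw h.2

end HarmonicMapping

/-! ### The counting formula -/

open HarmonicMapping in
theorem theorem3p3 (f : ℂ → ℂ) (P : Finset ℂ) (hf : HarmonicMapping.IsNondegenerate f P)
    (η : ℂ) (hη : η ∉ f '' HarmonicMapping.criticalSet f P)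
    (hinf : ∀ᶠ z in Bornology.cobounded ℂ, f z - η ≠ 0) :
    (HarmonicMapping.criticalComponents f P).Finite ∧
    (∀ Γ ∈ HarmonicMapping.criticalComponents f P,
      ∃ γ, HarmonicMapping.IsCriticalCurve f P Γ γ) ∧
    (HarmonicMapping.preimages f P η).Finite ∧
    ∀ γ : HarmonicMapping.criticalComponents f P → HarmonicMapping.Curve,
      (∀ Γ : HarmonicMapping.criticalComponents f P, HarmonicMapping.IsCriticalCurve f P Γ.1 (γ Γ)) →
      ((HarmonicMapping.preimages f P η).ncard : ℝ) =
        2 * (∑ᶠ Γ, HarmonicMapping.winding (fun z => f z - η) (γ Γ))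
          + HarmonicMapping.poleCount f P
          - HarmonicMapping.indexInfty (fun z => f z - η) := by
  classical
  obtain ⟨u, v, hcop, huv, hdil, hmul⟩ := hf.exists_rational_dilatation
  have hpole : ∀ p, ∃ k : ℤ, p ∈ P → (∀ η, HasLocalIndex (fun z => f z - η) p k) ∧
      (‖u.eval p‖ < ‖v.eval p‖ ∧ k ≤ 0 ∨ ‖v.eval p‖ < ‖u.eval p‖ ∧ 0 ≤ k) := by
    intro p
    by_cases hp : p ∈ P
    · obtain ⟨k, hk⟩ := hf.exists_index_pole hcop hmul hp
      exact ⟨k, fun _ => hk⟩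
    · exact ⟨0, fun h => absurd h hp⟩
  choose N hN using hpole
  have hPne : ∀ p ∈ P, ‖u.eval p‖ ≠ ‖v.eval p‖ := fun p hp =>
    (hN p hp).2.elim (fun h => h.1.ne) (fun h => h.1.ne')
  set L := {z | ‖u.eval z‖ = ‖v.eval z‖} with hLdef
  have hset : criticalSet f P \ exceptionalSet f P = L :=
    criticalSet_sdiff_exceptionalSet hcop hdil hmul hPne
  have hcomp : criticalComponents f P = {Γ | ∃ z ∈ L, Γ = connectedComponentIn L z} := by
    rw [criticalComponents, hset]
  have hLP : ∀ z ∈ L, z ∉ P := fun z hz h => hPne z h hz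
  have hLv : ∀ z ∈ L, v.eval z ≠ 0 := fun z hz => eval_right_ne_zero_of_isCoprime hcop hz
  have hΓL : ∀ Γ ∈ criticalComponents f P, Γ ⊆ L := by
    rw [hcomp]
    rintro Γ ⟨z, -, rfl⟩
    exact connectedComponentIn_subset _ _
  obtain ⟨hfin, hcurve⟩ := exists_curve_of_level_component hcop huv
  rw [← hLdef] at hfin hcurve
  rw [← hcomp] at hfin
  have hZ := hf.finite_preimages hη hinf
  refine ⟨hfin, fun Γ hΓ => ?_, hZ, fun γ hγ => ?_⟩
  · have hsub := hΓL Γ hΓ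
    rw [hcomp] at hΓ
    obtain ⟨x, hx, rfl⟩ := hΓ
    obtain ⟨γ, h1, h2, h3, h4⟩ := hcurve x hx
    refine ⟨γ, h1, h2, fun t ht => ?_, fun z hz hd => ?_⟩
    · have hL : γ.toFun t ∈ L := hsub (h2 ▸ mem_image_of_mem _ ht)
      rw [hdil _ (hLP _ hL), h3 t ht, mul_div_cancel_right₀ _ (hLv _ hL)]
    · have hL := hsub hz
      exact h4 z hz ((deriv_dilatation_ne_zero_iff hdil (hLP z hL) (hLv z hL)).1 hd)
  have hft : Fintype (criticalComponents f P) := hfin.fintype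
  have hmemΓ : ∀ Γ : criticalComponents f P, ∀ t ∈ Icc (γ Γ).a (γ Γ).b,
      (γ Γ).toFun t ∈ Γ.1 := fun Γ t ht => (hγ Γ).trace ▸ mem_image_of_mem _ ht
  have hmemL : ∀ Γ : criticalComponents f P, ∀ t ∈ Icc (γ Γ).a (γ Γ).b,
      (γ Γ).toFun t ∈ L := fun Γ t ht => hΓL _ Γ.2 (hmemΓ Γ t ht)
  have hwind : ∀ x, ‖u.eval x‖ ≠ ‖v.eval x‖ →
      ∑ Γ, argChange (fun t => (γ Γ).toFun t - x) (γ Γ).a (γ Γ).b =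
        if ‖u.eval x‖ < ‖v.eval x‖ then 0 else -1 := by
    intro x hx
    refine sum_argChange_curve_sub hcop huv γ (fun Γ => (hγ Γ).closed) (fun Γ t ht => ?_)
      (fun z hz hw => ?_) (fun Γ Γ' s hs t ht hst hw => ?_) hx
    · have hL := hmemL Γ t ht
      have := (hγ Γ).dilatation_eq t ht
      rw [hdil _ (hLP _ hL)] at this
      rw [← this, div_mul_cancel₀ _ (hLv _ hL)]
    · have hmem : connectedComponentIn L z ∈ criticalComponents f P := by
        rw [hcomp]; exact ⟨z, hz, rfl⟩
      obtain ⟨t, ht, -⟩ := (hγ ⟨_, hmem⟩).once z (mem_connectedComponentIn hz)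
        ((deriv_dilatation_ne_zero_iff hdil (hLP z hz) (hLv z hz)).2 hw)
      exact ⟨⟨_, hmem⟩, t, ht.1, ht.2⟩
    · have h1 := hmemΓ Γ s (Ico_subset_Icc_self hs)
      have h2 := hmemΓ Γ' t (Ico_subset_Icc_self ht)
      have hL := hmemL Γ s (Ico_subset_Icc_self hs)
      rw [← hst] at h2
      have hΓΓ' : Γ = Γ' := by
        have hcc : ∀ Δ : criticalComponents f P, (γ Γ).toFun s ∈ Δ.1 →
            Δ.1 = connectedComponentIn L ((γ Γ).toFun s) := by
          rintro ⟨Δ, hΔ⟩ hs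
          rw [hcomp] at hΔ
          obtain ⟨y, -, rfl⟩ := hΔ
          exact connectedComponentIn_eq hs
        exact Subtype.ext ((hcc Γ h1).trans (hcc Γ' h2).symm)
      subst hΓΓ'
      exact ⟨rfl, ((hγ Γ).once _ h1
        ((deriv_dilatation_ne_zero_iff hdil (hLP _ hL) (hLv _ hL)).2 hw)).unique
          ⟨hs, rfl⟩ ⟨ht, hst.symm⟩⟩
  set Z := hZ.toFinset with hZdef
  have hmemZ : ∀ z, z ∈ Z ↔ z ∉ P ∧ f z = η := fun z => hZ.mem_toFinset
  have hdisj : Disjoint P Z :=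
    Finset.disjoint_left.2 fun z hz hz' => ((hmemZ z).1 hz').1 hz
  have hJZ : ∀ z ∈ Z, jacobian f z ≠ 0 := fun z hz h =>
    hη ⟨z, ⟨((hmemZ z).1 hz).1, h⟩, ((hmemZ z).1 hz).2⟩
  let n : ℂ → ℤ := fun z => if z ∈ P then N z else if 0 < jacobian f z then 1 else -1
  have hnP : ∀ p ∈ P, n p = N p := fun p hp => if_pos hp
  have hnZ : ∀ z ∈ Z, n z = if 0 < jacobian f z then 1 else -1 := fun z hz =>
    if_neg ((hmemZ z).1 hz).1
  have hZnorm : ∀ z ∈ Z, ‖u.eval z‖ < ‖v.eval z‖ ∧ n z = 1 ∨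
      ‖v.eval z‖ < ‖u.eval z‖ ∧ n z = -1 := by
    intro z hz
    have hm := hmul z ((hmemZ z).1 hz).1
    rw [hnZ z hz]
    split_ifs with h
    · refine Or.inl ⟨norm_eval_lt_of_mul_eq hcop hm ?_, rfl⟩
      rw [Complex.norm_conj]
      exact lt_of_pow_lt_pow_left₀ 2 (norm_nonneg _) (sub_pos.1 h)
    · refine Or.inr ⟨norm_eval_lt_of_mul_eq hcop.symm hm.symm ?_, rfl⟩
      rw [Complex.norm_conj]
      have := lt_of_le_of_ne (not_lt.1 h) (hJZ z hz)
      exact lt_of_pow_lt_pow_left₀ 2 (norm_nonneg _) (sub_neg.1 this)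
  have hSne : ∀ a ∈ P ∪ Z, ‖u.eval a‖ ≠ ‖v.eval a‖ := by
    intro a ha
    rcases Finset.mem_union.1 ha with h | h
    · exact hPne a h
    · exact (hZnorm a h).elim (fun h => h.1.ne) (fun h => h.1.ne')
  obtain ⟨R, hR⟩ := (P ∪ Z).finite_toSet.isBounded.exists_norm_le
  -- `K` contains the critical curves and all large circles, so a single factorization yields both
  -- the windings and the index at infinity.
  let K : Set ℂ := L ∪ {z | R + 1 ≤ ‖z‖}
  have hKclosed : IsClosed K :=
    (isClosed_eq u.continuous.norm v.continuous.norm).union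
      (isClosed_le continuous_const continuous_norm)
  have hKS : ∀ a ∈ P ∪ Z, a ∉ K := by
    rintro a ha (h | h)
    · exact hSne a ha h
    · have h1 : R + 1 ≤ ‖a‖ := h
      linarith [hR a ha]
  obtain ⟨l, hl, hfac⟩ := exists_log_factorization n (P ∪ Z) (fun z => f z - η)
    (fun z hz => (hf.continuousAt fun h => hz (Finset.mem_union_left _ h)).sub continuousAt_const)
    (fun z hz h => hz (Finset.mem_union_right _ ((hmemZ z).2
      ⟨fun h => hz (Finset.mem_union_left _ h), sub_eq_zero.1 h⟩)))
    (fun a ha => by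
      rcases Finset.mem_union.1 ha with h | h
      · rw [hnP a h]; exact (hN a h).1 η
      · obtain ⟨haP, haη⟩ := (hmemZ a).1 h
        rw [hnZ a h]
        exact hasLocalIndex_of_jacobian_ne_zero
          ((eventually_notMem_nhds haP).mono fun w hw => hf.continuousAt hw)
          (hf.differentiableAt haP) haη (hJZ a h)) K hKclosed hKS
  have hinfty := indexInfty_eq hl hfac (R₀ := R + 1) (fun z hz => Or.inr hz) hKS
  have hV : ∑ Γ, winding (fun z => f z - η) (γ Γ) =
      ∑ a ∈ P ∪ Z, (n a : ℝ) * if ‖u.eval a‖ < ‖v.eval a‖ then 0 else -1 := by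
    have h1 : ∀ Γ, winding (fun z => f z - η) (γ Γ) = ∑ a ∈ P ∪ Z,
        (n a : ℝ) * argChange (fun t => (γ Γ).toFun t - a) (γ Γ).a (γ Γ).b := fun Γ =>
      argChange_comp_eq_sum hl hfac hKS (γ Γ).a_lt_b.le (γ Γ).continuousOn
        (fun t ht => Or.inl (hmemL Γ t ht)) (hγ Γ).closed
    simp only [h1]
    rw [Finset.sum_comm]
    refine Finset.sum_congr rfl fun a ha => ?_
    rw [← Finset.mul_sum, hwind a (hSne a ha)]
  have hpc : poleCount f P = ∑ p ∈ P, |(n p : ℝ)| := by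
    refine Finset.sum_congr rfl fun p hp => ?_
    -- The local index at a pole is the same for all η; the case η = 0 is the index of `f` itself.
    have := ((hN p hp).1 0).index_eq
    simp only [sub_zero] at this
    rw [this, hnP p hp]
  rw [finsum_eq_sum_of_fintype, hV, hpc, hinfty, Set.ncard_eq_toFinset_card _ hZ, ← hZdef,
    Finset.sum_union hdisj, Finset.sum_union hdisj]
  -- Each pole contributes 0: n + |n| with n ≤ 0 where |ω| < 1, and -2n + |n| + n with n ≥ 0 where
  -- |ω| > 1.
  have hPsum : ∑ p ∈ P, (2 * ((n p : ℝ) * if ‖u.eval p‖ < ‖v.eval p‖ then 0 else -1) +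
      |(n p : ℝ)| + n p) = 0 := by
    refine Finset.sum_eq_zero fun p hp => ?_
    rw [hnP p hp]
    rcases (hN p hp).2 with ⟨h1, h2⟩ | ⟨h1, h2⟩
    · have h2' : (N p : ℝ) ≤ 0 := by exact_mod_cast h2
      rw [if_pos h1, abs_of_nonpos h2']; ring
    · have h2' : (0 : ℝ) ≤ N p := by exact_mod_cast h2
      rw [if_neg h1.not_gt, abs_of_nonneg h2']; ring
  -- Each preimage contributes 1: 0 + 1 where |ω| < 1, and 2 - 1 where |ω| > 1.
  have hZsum : ∑ z ∈ Z, (2 * ((n z : ℝ) * if ‖u.eval z‖ < ‖v.eval z‖ then 0 else -1) + n z) =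
      (Z.card : ℝ) := by
    rw [Finset.card_eq_sum_ones, Nat.cast_sum]
    refine Finset.sum_congr rfl fun z hz => ?_
    rcases hZnorm z hz with ⟨h1, h2⟩ | ⟨h1, h2⟩
    · rw [if_pos h1, h2]; norm_num
    · rw [if_neg h1.not_gt, h2]; norm_num
  simp only [Finset.sum_add_distrib, ← Finset.mul_sum] at hPsum hZsum
  linarith
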